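/- Let $G=\operatorname{PGL}_2(\mathbb R)$ and $\Lambda=\operatorname{PGL}_2(\mathbb Z)$, i.e. the image of $\operatorname{GL}_2(\mathbb Z)$ in $G$. Let $X=G/\Lambda$, let $x_0\in X$ be the coset $\Lambda$, and let $m_X$ be the $G$-invariant Borel probability measure on $X$. For $t,\alpha\in\mathbb R$ let $a_t,u_\alpha\in G$ be the classes of $$\begin{bmatrix} e^{t}&0\\0&e^{-t}\end{bmatrix},\qquad \begin{bmatrix}1&-\alpha\\0&1\end{bmatrix}.$$ Let $\mathcal G(x)=\frac1x-\lfloor\frac1x\rfloor$ be the Gauss map, and let $\mu_{\mathcal G}$ be the Gauss measure on $(0,1)$, $d\mu_{\mathcal G}(x)=\frac1{\log 2}\frac{dx}{1+x}$. Write $\mathbb N=\{1,2,\dots\}$. The Gauss measure on $\mathbb N^{\mathbb N}$ is the image of $\mu_{\mathcal G}$ under the map sending an irrational $x=[0;b_1,b_2,\dots]\in(0,1)$ to its sequence $(b_1,b_2,\dots)$ of continued fraction coefficients, and $T$ is the shift map on $\mathbb N^{\mathbb N}$. A path $(x_t)_{t\ge0}$ (respectively a sequence $(x_n)_{n\ge0}$)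 in a topological space $Y$ is equidistributed with respect to a Borel probability measure $\mu$ on $Y$ if for every bounded continuous $F:Y\to\mathbb R$, $\frac1{\tau}\int_0^{\tau} F(x_t)\,dt\to\int F\,d\mu$ as $\tau\to\infty$ (respectively $\frac1N\sum_{n<N}F(x_n)\to\int F\,d\mu$ as $N\to\infty$). **Theorem.** Fix $\alpha\in(0,1)$, and suppose that the orbit $(a_tu_\alpha x_0)_{t\ge0}$ is equidistributed in $X$ with respect to $m_X$. Then: (a) the orbit $(\mathcal G^n\alpha)_{n\ge 0}$ stays in $(0,1)$ and is equidistributed there with respect to the Gauss measure $\mu_{\mathcal G}$; (b) $\alpha$ has an infinite continued fraction expansion $\alpha=[0;b_1,b_2,\dots]$, and, with $b=(b_1,b_2,\dots)$, the sequence $(T^nb)_{n\ge 0}$ is equidistributed in $\mathbb N^{\mathbb N}$ with respect to the Gauss measure. Moreover, for every irrational $\alpha\in(0,1)$ (with no assumption on the orbit $(a_tu_\alpha x_0)_{t\ge0}$), statements (a) and (b) are equivalent. -/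

import Mathlib

open MeasureTheory Filter Topology
open scoped MatrixGroups BoundedContinuousFunction

noncomputable section

namespace GaussEquidistribution

/-! ### Equidistribution -/

/-- The sequence `x` is equidistributed with respect to `μ`: the sampling measures
`N⁻¹ ∑_{n < N} δ_{x n}` converge weakly to `μ`. -/
def SeqEquidistributed {Y : Type*} [TopologicalSpace Y] [MeasurableSpace Y]
    (x : ℕ → Y) (μ : Measure Y) : Prop :=
  ∀ F : Y →ᵇ ℝ,
    Tendsto (fun N : ℕ => (N : ℝ)⁻¹ * ∑ n ∈ Finset.range N, F (x n)) atTop (𝓝 (∫ y, F y ∂μ))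

/-- The path `(x t)_{t ≥ 0}` is equidistributed with respect to `μ`: the sampling measures
`T⁻¹ ∫_0^T δ_{x t} dt` converge weakly to `μ`. -/
def PathEquidistributed {Y : Type*} [TopologicalSpace Y] [MeasurableSpace Y]
    (x : ℝ → Y) (μ : Measure Y) : Prop :=
  ∀ F : Y →ᵇ ℝ,
    Tendsto (fun T : ℝ => T⁻¹ * ∫ t in (0 : ℝ)..T, F (x t)) atTop (𝓝 (∫ y, F y ∂μ))

/-! ### The homogeneous space `PGL₂(ℝ) / PGL₂(ℤ)` -/

/-- `PGL₂(ℝ)` carries the quotient topology from `GL₂(ℝ)`. -/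
instance : TopologicalSpace PGL(2, ℝ) :=
  TopologicalSpace.coinduced (Matrix.ProjGenLinGroup.mk : GL (Fin 2) ℝ → PGL(2, ℝ)) inferInstance

/-- `PGL₂(ℤ)` as a subgroup of `PGL₂(ℝ)`: the classes of the matrices in `GL₂(ℤ)`. -/
def Lam : Subgroup PGL(2, ℝ) :=
  ((Matrix.ProjGenLinGroup.mk : GL (Fin 2) ℝ →* PGL(2, ℝ)).comp
    (Matrix.GeneralLinearGroup.map (Int.castRingHom ℝ))).range

/-- The space `X = PGL₂(ℝ) / PGL₂(ℤ)` of left cosets. -/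
def X : Type := PGL(2, ℝ) ⧸ Lam

instance : MulAction PGL(2, ℝ) X := inferInstanceAs (MulAction PGL(2, ℝ) (PGL(2, ℝ) ⧸ Lam))

instance : TopologicalSpace X := inferInstanceAs (TopologicalSpace (PGL(2, ℝ) ⧸ Lam))

instance : MeasurableSpace X := borel X

instance : BorelSpace X := ⟨rfl⟩

/-- The base point `x₀`, the coset of the identity. -/
def x₀ : X := ((1 : PGL(2, ℝ)) : PGL(2, ℝ) ⧸ Lam)

/-- `a t` is the class of `diag(e^t, e^{-t})`. -/
def a (t : ℝ) : PGL(2, ℝ) :=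
  Matrix.ProjGenLinGroup.mk <|
    Matrix.GeneralLinearGroup.mkOfDetNeZero !![Real.exp t, 0; 0, Real.exp (-t)] (by
      simp [Matrix.det_fin_two])

/-- `u α` is the class of the unipotent matrix with upper right entry `-α`. -/
def u (α : ℝ) : PGL(2, ℝ) :=
  Matrix.ProjGenLinGroup.mk <|
    Matrix.GeneralLinearGroup.mkOfDetNeZero !![1, -α; 0, 1] (by
      simp [Matrix.det_fin_two])

/-! ### The Gauss map, the Gauss measure and continued fractions -/

/-- The Gauss map `x ↦ 1/x - ⌊1/x⌋`. -/
def gaussMap (x : ℝ) : ℝ := 1 / x - ⌊1 / x⌋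

/-- The Gauss measure `(log 2)⁻¹ dx / (1 + x)` on the open interval `(0, 1)`. -/
def gaussMeasure : Measure (Set.Ioo (0 : ℝ) 1) :=
  ((volume : Measure ℝ).comap Subtype.val).withDensity
    fun x => ENNReal.ofReal (1 / Real.log 2 * (1 / (1 + (x : ℝ))))

/-- `b` is the infinite sequence of continued fraction coefficients of `x`, that is
`x = [⌊x⌋; b 0, b 1, b 2, …]`. -/
def IsCFSequence (x : ℝ) (b : ℕ → ℕ+) : Prop :=
  ∀ n, (GenContFract.of x).partDens.get? n = some ((b n : ℕ) : ℝ)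

open Classical in
/-- The continued fraction coefficients of `x`, as a total function: `x` has an infinite continued
fraction expansion unless it is rational, and at rational points the value is immaterial. -/
def cfCode (x : ℝ) : ℕ → ℕ+ :=
  if h : ∃ b, IsCFSequence x b then h.choose else fun _ => 1

/-- The shift `(b₁, b₂, …) ↦ (b₂, b₃, …)`. -/
def shift (b : ℕ → ℕ+) : ℕ → ℕ+ := fun n => b (n + 1)

/-- The set of positive integers is discrete, and sequences of positive integers carry the product
topology and the product (that is, Borel) σ-algebra. -/
instance : MeasurableSpace ℕ+ := ⊤

instance : DiscreteMeasurableSpace ℕ+ := ⟨fun _ => trivial⟩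

/-- The Gauss measure on sequences of positive integers: the image of the Gauss measure on `(0, 1)`
under the continued fraction expansion. -/
def gaussMeasureSeq : Measure (ℕ → ℕ+) :=
  gaussMeasure.map fun x : Set.Ioo (0 : ℝ) 1 => cfCode (x : ℝ)

/-! ### The two forms of the conclusion -/

/-- The forward orbit of `α` under the Gauss map stays in `(0, 1)` and is equidistributed there
with respect to the Gauss measure. -/
def GaussOrbitEquidistributed (α : ℝ) : Prop :=
  ∃ x : ℕ → Set.Ioo (0 : ℝ) 1, (∀ n, (x n : ℝ) = gaussMap^[n] α) ∧
    SeqEquidistributed x gaussMeasure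

/-- `α` has an infinite continued fraction expansion, and the shifts of its sequence of
coefficients are equidistributed with respect to the Gauss measure. -/
def CFShiftsEquidistributed (α : ℝ) : Prop :=
  ∃ b : ℕ → ℕ+, IsCFSequence α b ∧ SeqEquidistributed (fun n => shift^[n] b) gaussMeasureSeq

end GaussEquidistribution

end

/-!
The proof compares the flow on `X` with the Gauss map by unfolding. For a compactly supported
function `φ` on `PGL₂(ℝ)`, the automorphic sum `gΛ ↦ ∑ γ ∈ Λ, φ (g γ)` is a bounded continuous
function on `X`, and by uniqueness of Haar measure its integral against the invariant probability
measure is a positive multiple of the Haar integral of `φ` (`exists_integral_autBCF_eq`).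

This is applied to functions adapted to the flow. A matrix of the form `(A, -x A; y D, D)` is
described by the point `(x, y)`, which the flow `a t` leaves fixed, and by the ratio of its two
diagonal entries, on which the flow acts as a translation of time. The test function attached to a
weight `ψ` supported in the unit square is `ψ (x, y)` times a bump of integral one in the time
variable. Its Haar integral is a constant times `∫ ψ (x, y) dx dy / (1 + x y)²`
(`lintegral_testFun`), the invariant density of the natural extension of the Gauss map. Along the
orbit of `u α`, the matrices in `Λ` that contribute to the automorphic sum are exactly the matrices
`(p_{n-1}, p_n; q_{n-1}, q_n)` of consecutive convergents of `α` (`exists_cfMat_eq`), with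
`x = x_n = 𝒢ⁿ α` and `y = y_n = q_{n-1} / q_n`, at the time `log q_n`. Integrating over the time
interval `[0, log q_N]` turns the hypothesis into
`(∑ n < N, ψ (x_n, y_n)) / log q_N → c ∫ ψ (x, y) dx dy / (1 + x y)²`
for every weight `ψ` (`exists_tendsto_sum_div_logDen`). For rational `α` only finitely many matrices
contribute, so that the orbit cannot be equidistributed (`irrational_of_pathEquidistributed`).

To replace `ψ` by a bounded continuous function of `x` alone, one has to rule out that mass escapes
to the boundary of the square. If `(x_n, y_n)` is within `1 / k` of the boundary, then
`log q_{j+1} - log q_j` is at least `log (k / 4)` for some `j` near `n`; these differences telescope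
to `log q_N`, so that there are at most `O(log q_N / log k)` such `n` (`sum_one_sub_cutoff_le`). The
marginal of `dx dy / (1 + x y)²` is `dx / (1 + x)`, and comparison with the constant function `1`
replaces the normalization by `log q_N` with the one by `N`
(`gaussOrbitEquidistributed_of_tendsto`).

The two forms of the conclusion are equivalent because the coding of irrational numbers by their
coefficients is a homeomorphism onto its image, and the rational numbers are a null set: weak
convergence passes to images under maps that are continuous on a set of full measure containing the
sequence (`SeqEquidistributed.map_of_continuousOn`).
-/

noncomputable section

namespace GaussEquidistribution

open scoped CompactlySupported

/-! ### The Gauss map and the matrices of convergents -/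

theorem gaussMap_mem_Ioo_of_irrational {x : ℝ} (hx : Irrational x) :
    gaussMap x ∈ Set.Ioo (0 : ℝ) 1 ∧ Irrational (gaussMap x) := by
  have h1 : Irrational (1 / x) := by simpa using hx.inv
  have h2 : Irrational (gaussMap x) := by
    rw [gaussMap]; exact h1.sub_intCast _
  refine ⟨⟨lt_of_le_of_ne (Int.fract_nonneg _) ?_, Int.fract_lt_one _⟩, h2⟩
  exact fun h => h2.ne_zero h.symm

theorem gaussMap_iterate_irrational {α : ℝ} (hα : Irrational α) (n : ℕ) :
    Irrational (gaussMap^[n] α) := by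
  induction n with
  | zero => exact hα
  | succ n ih =>
    rw [Function.iterate_succ_apply']
    exact (gaussMap_mem_Ioo_of_irrational ih).2

theorem gaussMap_iterate_mem_Ioo {α : ℝ} (hα : Irrational α) (h : α ∈ Set.Ioo (0 : ℝ) 1) (n : ℕ) :
    gaussMap^[n] α ∈ Set.Ioo (0 : ℝ) 1 := by
  cases n with
  | zero => exact h
  | succ n =>
    rw [Function.iterate_succ_apply']
    exact (gaussMap_mem_Ioo_of_irrational (gaussMap_iterate_irrational hα n)).1

/-- The continued fraction digit of index `n + 1` of `α ∈ (0, 1)`, read off the Gauss orbit. -/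
def cfDigit (α : ℝ) (n : ℕ) : ℤ := ⌊1 / gaussMap^[n] α⌋

theorem one_le_cfDigit {α : ℝ} (hα : Irrational α) (h : α ∈ Set.Ioo (0 : ℝ) 1) (n : ℕ) :
    1 ≤ cfDigit α n := by
  obtain ⟨h0, h1⟩ := gaussMap_iterate_mem_Ioo hα h n
  rw [cfDigit, Int.le_floor, le_div_iff₀ h0]
  push_cast
  linarith

theorem one_div_gaussMap_iterate (α : ℝ) (n : ℕ) :
    1 / gaussMap^[n] α = cfDigit α n + gaussMap^[n + 1] α := by
  rw [Function.iterate_succ_apply', cfDigit, gaussMap]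
  ring

theorem gaussMap_iterate_mul {α : ℝ} (hα : Irrational α) (n : ℕ) :
    gaussMap^[n] α * (cfDigit α n + gaussMap^[n + 1] α) = 1 := by
  rw [← one_div_gaussMap_iterate, mul_one_div_cancel (gaussMap_iterate_irrational hα n).ne_zero]

theorem floor_one_div_one_div_add {k : ℤ} {x : ℝ} (hx : x ∈ Set.Ioo (0 : ℝ) 1) :
    ⌊1 / (1 / ((k : ℝ) + x))⌋ = k := by
  rw [one_div_one_div, Int.floor_eq_iff]
  constructor <;> linarith [hx.1, hx.2]

theorem gaussMap_one_div_add {k : ℤ} {x : ℝ} (hx : x ∈ Set.Ioo (0 : ℝ) 1) :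
    gaussMap (1 / ((k : ℝ) + x)) = x := by
  rw [gaussMap, floor_one_div_one_div_add hx, one_div_one_div]
  ring

/-- The matrix `(p_{n-1}, p_n; q_{n-1}, q_n)` of two consecutive convergents of `α ∈ (0, 1)`. -/
def cfMat (α : ℝ) : ℕ → Matrix (Fin 2) (Fin 2) ℤ
  | 0 => 1
  | n + 1 => cfMat α n * !![0, 1; 1, cfDigit α n]

/-- The denominator `q_n` of the convergent of index `n` of `α`. -/
def cfDen (α : ℝ) (n : ℕ) : ℤ := cfMat α n 1 1

theorem cfMat_succ (α : ℝ) (n : ℕ) :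
    cfMat α (n + 1) = !![cfMat α n 0 1, cfMat α n 0 0 + cfMat α n 0 1 * cfDigit α n;
      cfMat α n 1 1, cfMat α n 1 0 + cfMat α n 1 1 * cfDigit α n] := by
  rw [cfMat]
  ext i j
  fin_cases i <;> fin_cases j <;> simp [Matrix.mul_apply, Fin.sum_univ_two]

theorem det_cfMat (α : ℝ) (n : ℕ) : (cfMat α n).det = (-1) ^ n := by
  induction n with
  | zero => simp [cfMat]
  | succ n ih => rw [cfMat, Matrix.det_mul, ih, Matrix.det_fin_two_of]; ring

theorem cfMat_succ_one_zero (α : ℝ) (n : ℕ) : cfMat α (n + 1) 1 0 = cfDen α n := by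
  simp [cfMat_succ, cfDen]

theorem cfDen_succ (α : ℝ) (n : ℕ) :
    cfDen α (n + 1) = cfMat α n 1 0 + cfDen α n * cfDigit α n := by
  simp [cfMat_succ, cfDen]

theorem cfMat_one_zero_bounds {α : ℝ} (hα : Irrational α) (h : α ∈ Set.Ioo (0 : ℝ) 1) (n : ℕ) :
    0 ≤ cfMat α n 1 0 ∧ cfMat α n 1 0 ≤ cfDen α n ∧ 1 ≤ cfDen α n := by
  induction n with
  | zero => simp [cfDen, cfMat]
  | succ n ih =>
    have hb := one_le_cfDigit hα h n
    rw [cfMat_succ_one_zero, cfDen_succ]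
    obtain ⟨h1, h2, h3⟩ := ih
    refine ⟨by linarith, ?_, ?_⟩ <;> nlinarith

theorem one_le_cfDen {α : ℝ} (hα : Irrational α) (h : α ∈ Set.Ioo (0 : ℝ) 1) (n : ℕ) :
    1 ≤ cfDen α n := (cfMat_one_zero_bounds hα h n).2.2

theorem cfDen_monotone {α : ℝ} (hα : Irrational α) (h : α ∈ Set.Ioo (0 : ℝ) 1) :
    Monotone (cfDen α) := by
  refine monotone_nat_of_le_succ fun n => ?_
  rw [← cfMat_succ_one_zero]
  exact (cfMat_one_zero_bounds hα h (n + 1)).2.1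

theorem two_mul_cfDen_le {α : ℝ} (hα : Irrational α) (h : α ∈ Set.Ioo (0 : ℝ) 1) (n : ℕ) :
    2 * cfDen α n ≤ cfDen α (n + 2) := by
  rw [cfDen_succ, cfMat_succ_one_zero]
  have hb := one_le_cfDigit hα h (n + 1)
  have h1 := cfDen_monotone hα h (Nat.le_succ n)
  have h2 := one_le_cfDen hα h n
  simp only [Nat.succ_eq_add_one] at h1
  nlinarith

theorem cfDen_lt_succ {α : ℝ} (hα : Irrational α) (h : α ∈ Set.Ioo (0 : ℝ) 1) (n : ℕ) :
    cfDen α (n + 1) < cfDen α (n + 2) := by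
  rw [cfDen_succ α (n + 1), cfMat_succ_one_zero]
  have hb := one_le_cfDigit hα h (n + 1)
  have h1 := one_le_cfDen hα h n
  have h2 := one_le_cfDen hα h (n + 1)
  nlinarith

/-- `α` is the image of the `n`-th point of its Gauss orbit under the `n`-th matrix. -/
theorem cfMat_moebius {α : ℝ} (hα : Irrational α) (n : ℕ) :
    α * (cfMat α n 1 0 * gaussMap^[n] α + cfMat α n 1 1)
      = cfMat α n 0 0 * gaussMap^[n] α + cfMat α n 0 1 := by
  induction n with
  | zero => simp [cfMat]
  | succ n ih =>
    have hx := gaussMap_iterate_mul hα n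
    have h0 := (gaussMap_iterate_irrational hα n).ne_zero
    rw [cfMat_succ]
    simp only [Matrix.of_apply, Matrix.cons_val', Matrix.cons_val_zero, Matrix.cons_val_one,
      Matrix.cons_val_fin_one]
    push_cast
    refine mul_left_cancel₀ h0 ?_
    linear_combination ih + (α * cfMat α n 1 1 - cfMat α n 0 1) * hx

/-- Every integral matrix of determinant `±1` with bottom row `0 < c < d` that maps a point
`x ∈ (0, 1)` to `α` is one of the matrices of convergents, and `x` is the matching point of the
Gauss orbit. The proof runs the Euclidean algorithm on the bottom row. -/
theorem exists_cfMat_eq {α : ℝ} (h : α ∈ Set.Ioo (0 : ℝ) 1) (N : ℕ) :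
    ∀ (a b c d : ℤ) (x : ℝ), d ≤ N → x ∈ Set.Ioo (0 : ℝ) 1 → 0 < c → c < d →
      IsUnit (a * d - b * c) → α * (c * x + d) = a * x + b →
      ∃ n, cfMat α n = !![a, b; c, d] ∧ x = gaussMap^[n] α := by
  induction N with
  | zero => intro a b c d x hd _ hc hcd; norm_cast at hd; omega
  | succ N ih =>
    intro a b c d x hd hx hc hcd hdet hm
    obtain ⟨k, r, hr0, hrc, hdk⟩ : ∃ k r : ℤ, 0 ≤ r ∧ r < c ∧ d = k * c + r :=
      ⟨d / c, d % c, Int.emod_nonneg _ hc.ne', Int.emod_lt_of_pos _ hc,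
        by rw [mul_comm]; exact (Int.mul_ediv_add_emod d c).symm⟩
    have hk : 1 ≤ k := by
      by_contra hk
      have : k ≤ 0 := by omega
      nlinarith
    have hkR : (1 : ℝ) ≤ k := by exact_mod_cast hk
    have hpos : 0 < (k : ℝ) + x := by linarith [hx.1]
    have hx' : 1 / ((k : ℝ) + x) ∈ Set.Ioo (0 : ℝ) 1 :=
      ⟨by positivity, by rw [div_lt_one hpos]; linarith [hx.1]⟩
    have hdR : (d : ℝ) = k * c + r := by exact_mod_cast hdk
    rcases hr0.eq_or_lt with hr | hr
    · -- the remainder vanishes, so that `c = 1` and `d = k`; according to the sign of the determinant,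
      -- `α` is `1 - 1 / (d + x) = 1 / (1 + 1 / (d - 1 + x))` or `1 / (d + x)`
      subst hr
      rw [add_zero] at hdk
      have hc1 : c = 1 := by
        have : c ∣ a * d - b * c := ⟨a * k - b, by rw [hdk]; ring⟩
        exact (Int.isUnit_iff.1 (isUnit_of_dvd_unit this hdet)).resolve_right (by omega)
      subst hc1
      simp only [mul_one] at hdk
      subst hdk
      push_cast at hm
      rw [one_mul] at hm
      simp only [mul_one, Int.isUnit_iff] at hdet
      have hd2 : (2 : ℝ) ≤ d := by exact_mod_cast hcd
      rcases hdet with hdet | hdet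
      · have hb : b = a * d - 1 := by omega
        have hbR : (b : ℝ) = a * d - 1 := by exact_mod_cast hb
        have e1 : α = a - 1 / (d + x) := by
          field_simp
          rw [hbR] at hm
          linear_combination hm
        have ha : a = 1 := by
          have h1 : (0 : ℝ) < a := by linarith [h.1, hx'.1]
          have h2 : (a : ℝ) < 2 := by linarith [h.2, hx'.2]
          norm_cast at h1 h2
          omega
        subst ha
        have hpos' : 0 < ((d - 1 : ℤ) : ℝ) + x := by push_cast; linarith [hx.1]
        have hx1 : 1 / (((d - 1 : ℤ) : ℝ) + x) ∈ Set.Ioo (0 : ℝ) 1 := by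
          refine ⟨by positivity, ?_⟩
          rw [div_lt_one hpos']
          push_cast
          linarith [hx.1]
        have e2 : α = 1 / (((1 : ℤ) : ℝ) + 1 / (((d - 1 : ℤ) : ℝ) + x)) := by
          rw [e1]
          have : (d : ℝ) - 1 + x ≠ 0 := by push_cast at hpos'; exact hpos'.ne'
          push_cast
          field_simp
          ring_nf
          field_simp
          ring
        have g1 : gaussMap α = 1 / (((d - 1 : ℤ) : ℝ) + x) := by
          rw [e2, gaussMap_one_div_add hx1]
        refine ⟨2, ?_, ?_⟩
        · have d0 : cfDigit α 0 = 1 := by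
            rw [cfDigit, Function.iterate_zero_apply, e2, floor_one_div_one_div_add hx1]
          have d1 : cfDigit α 1 = d - 1 := by
            rw [cfDigit, Function.iterate_one, g1, floor_one_div_one_div_add hx]
          rw [cfMat_succ, cfMat_succ, d0, d1, hb]
          ext i j
          fin_cases i <;> fin_cases j <;> simp [cfMat]
        · rw [Function.iterate_succ_apply', Function.iterate_one, g1, gaussMap_one_div_add hx]
      · have hb : b = a * d + 1 := by omega
        have hbR : (b : ℝ) = a * d + 1 := by exact_mod_cast hb
        have e1 : α = a + 1 / (d + x) := by
          field_simp
          rw [hbR] at hm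
          linear_combination hm
        have ha : a = 0 := by
          have h1 : (-1 : ℝ) < a := by linarith [h.1, hx'.2]
          have h2 : (a : ℝ) < 1 := by linarith [h.2, hx'.1]
          norm_cast at h1 h2
          omega
        subst ha
        push_cast at e1
        rw [zero_add] at e1
        refine ⟨1, ?_, ?_⟩
        · have d0 : cfDigit α 0 = d := by
            rw [cfDigit, Function.iterate_zero_apply, e1, floor_one_div_one_div_add hx]
          rw [cfMat_succ, d0, hb]
          ext i j
          fin_cases i <;> fin_cases j <;> simp [cfMat]
        · rw [Function.iterate_one, e1, gaussMap_one_div_add hx]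
    · obtain ⟨n, hn, hxn⟩ := ih (b - k * a) a r c (1 / (k + x)) (by push_cast at hd; omega) hx' hr hrc
        (by
          have : (b - k * a) * c - a * r = -(a * d - b * c) := by rw [hdk]; ring
          rw [this]; exact hdet.neg)
        (by
          field_simp
          push_cast
          rw [hdR] at hm
          linear_combination hm)
      have hdig : cfDigit α n = k := by rw [cfDigit, ← hxn, floor_one_div_one_div_add hx]
      refine ⟨n + 1, ?_, ?_⟩
      · rw [cfMat_succ, hn, hdig, hdk]
        ext i j
        fin_cases i <;> fin_cases j <;> simp <;> ring
      · rw [Function.iterate_succ_apply', ← hxn, gaussMap_one_div_add hx]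

/-- If `α` is rational, only finitely many bottom rows `0 < c < d` occur for integral matrices of
determinant `±1` that map a point of `(0, 1)` to `α`. -/
theorem exists_bound_of_not_irrational {α : ℝ} (hα : ¬ Irrational α) :
    ∃ Q : ℕ, 0 < Q ∧ ∀ (a b c d : ℤ) (x : ℝ), x ∈ Set.Ioo (0 : ℝ) 1 → 0 < c → c < d →
      IsUnit (a * d - b * c) → α * (c * x + d) = a * x + b → d ≤ Q := by
  obtain ⟨s, rfl⟩ : ∃ s : ℚ, (s : ℝ) = α := by simpa [Irrational] using hα
  refine ⟨s.den, s.den_pos, fun a b c d x hx hc hcd hdet hm => ?_⟩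
  have hcR : (0 : ℝ) < c := by exact_mod_cast hc
  have hdR : (0 : ℝ) < d := by exact_mod_cast hc.trans hcd
  have hs : (s : ℝ) * s.den = s.num := by exact_mod_cast Rat.mul_den_eq_num s
  have hden : (0 : ℝ) < s.den := by exact_mod_cast s.den_pos
  have key : ((s.num * d - b * s.den : ℤ) : ℝ) * (c * x + d)
      = s.den * (x * ((a * d - b * c : ℤ) : ℝ)) := by
    push_cast
    rw [← hs]
    linear_combination (s.den : ℝ) * d * hm
  have habs : |((a * d - b * c : ℤ) : ℝ)| = 1 := by
    rcases Int.isUnit_iff.1 hdet with e | e <;> rw [e] <;> simp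
  have hcx : 0 < c * x + d := by have := mul_pos hcR hx.1; linarith
  have key2 : |((s.num * d - b * s.den : ℤ) : ℝ)| * (c * x + d) = s.den * x := by
    have := congrArg abs key
    rwa [abs_mul, abs_mul, abs_mul, habs, abs_of_pos hcx, abs_of_pos hden, abs_of_pos hx.1,
      mul_one] at this
  have hne : s.num * d - b * s.den ≠ 0 := by
    intro e
    rw [e] at key2
    have := mul_pos hden hx.1
    simp at key2
    linarith [hx.1]
  have h1 : (1 : ℝ) ≤ |((s.num * d - b * s.den : ℤ) : ℝ)| := by
    exact_mod_cast Int.one_le_abs hne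
  have : (d : ℝ) ≤ s.den := by
    have e1 : (c * x + d) ≤ s.den * x := by rw [← key2]; nlinarith
    nlinarith [hx.1, hx.2, mul_pos hcR hx.1]
  exact_mod_cast this

/-! ### The topology of `PGL₂(ℝ)` -/

instance : IsTopologicalGroup PGL(2, ℝ) :=
  inferInstanceAs (IsTopologicalGroup (GL (Fin 2) ℝ ⧸ Subgroup.center (GL (Fin 2) ℝ)))

instance : T2Space PGL(2, ℝ) := by
  have : IsClosed (Subgroup.center (GL (Fin 2) ℝ) : Set (GL (Fin 2) ℝ)) := by
    have h := Set.isClosed_centralizer (Set.univ : Set (GL (Fin 2) ℝ))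
    rwa [Set.centralizer_univ] at h
  exact inferInstanceAs (T2Space (GL (Fin 2) ℝ ⧸ Subgroup.center (GL (Fin 2) ℝ)))

instance : MeasurableSpace PGL(2, ℝ) := borel _

instance : BorelSpace PGL(2, ℝ) := ⟨rfl⟩

theorem isQuotientMap_mk :
    IsQuotientMap (Matrix.ProjGenLinGroup.mk : GL (Fin 2) ℝ → PGL(2, ℝ)) :=
  ⟨⟨rfl⟩, Matrix.ProjGenLinGroup.mk_surjective⟩

/-- The class in `PGL₂(ℝ)` of a real matrix, with value `1` at singular matrices. -/
def ofMat (M : Matrix (Fin 2) (Fin 2) ℝ) : PGL(2, ℝ) :=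
  if h : M.det ≠ 0 then
    Matrix.ProjGenLinGroup.mk (Matrix.GeneralLinearGroup.mkOfDetNeZero M h) else 1

theorem det_coe_ne_zero (M : GL (Fin 2) ℝ) : (M : Matrix (Fin 2) (Fin 2) ℝ).det ≠ 0 :=
  M.det.ne_zero

theorem coe_mkOfDetNeZero {M : Matrix (Fin 2) (Fin 2) ℝ} (hM : M.det ≠ 0) :
    (Matrix.GeneralLinearGroup.mkOfDetNeZero M hM : Matrix (Fin 2) (Fin 2) ℝ) = M := rfl

theorem ofMat_coe (M : GL (Fin 2) ℝ) : ofMat M = Matrix.ProjGenLinGroup.mk M := by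
  rw [ofMat, dif_pos (det_coe_ne_zero M)]
  congr 1
  exact Units.ext rfl

theorem ofMat_mul {M N : Matrix (Fin 2) (Fin 2) ℝ} (hM : M.det ≠ 0) (hN : N.det ≠ 0) :
    ofMat (M * N) = ofMat M * ofMat N := by
  have hMN : (M * N).det ≠ 0 := by rw [Matrix.det_mul]; exact mul_ne_zero hM hN
  rw [ofMat, ofMat, ofMat, dif_pos hM, dif_pos hN, dif_pos hMN, ← map_mul]
  congr 1
  ext i j
  rfl

theorem ofMat_smul {c : ℝ} (hc : c ≠ 0) (M : Matrix (Fin 2) (Fin 2) ℝ) :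
    ofMat (c • M) = ofMat M := by
  by_cases hM : M.det = 0
  · rw [ofMat, ofMat, dif_neg (by simp [hM]), dif_neg (by simp [hM])]
  · have hcM : (c • M).det ≠ 0 := by
      rw [Matrix.det_smul]; exact mul_ne_zero (pow_ne_zero _ hc) hM
    rw [ofMat, ofMat, dif_pos hM, dif_pos hcM, eq_comm, Matrix.ProjGenLinGroup.mk_eq_mk_iff]
    refine ⟨Units.mk0 c hc, ?_⟩
    refine Units.ext ?_
    rw [Units.val_mul, coe_mkOfDetNeZero, coe_mkOfDetNeZero]
    ext i j
    simp [mul_comm]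

theorem ofMat_eq_ofMat_iff {M N : Matrix (Fin 2) (Fin 2) ℝ} (hM : M.det ≠ 0) (hN : N.det ≠ 0) :
    ofMat M = ofMat N ↔ ∃ c : ℝ, c ≠ 0 ∧ N = c • M := by
  constructor
  · intro h
    rw [ofMat, ofMat, dif_pos hM, dif_pos hN, Matrix.ProjGenLinGroup.mk_eq_mk_iff] at h
    obtain ⟨c, hc⟩ := h
    refine ⟨c, c.ne_zero, ?_⟩
    have := congrArg (fun g : GL (Fin 2) ℝ => (g : Matrix (Fin 2) (Fin 2) ℝ)) hc
    simp only [Units.val_mul, coe_mkOfDetNeZero] at this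
    rw [← this]
    ext i j
    simp [mul_comm]
  · rintro ⟨c, hc, rfl⟩
    rw [ofMat_smul hc]

/-- Every class in `PGL₂(ℝ)` has a representative of determinant `±1`. -/
theorem exists_ofMat_eq (g : PGL(2, ℝ)) :
    ∃ M : Matrix (Fin 2) (Fin 2) ℝ, |M.det| = 1 ∧ ofMat M = g := by
  obtain ⟨M, rfl⟩ := Matrix.ProjGenLinGroup.mk_surjective g
  have hM : (M : Matrix (Fin 2) (Fin 2) ℝ).det ≠ 0 := det_coe_ne_zero M
  have hpos : 0 < √|(M : Matrix (Fin 2) (Fin 2) ℝ).det| := Real.sqrt_pos.2 (abs_pos.2 hM)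
  refine ⟨(√|(M : Matrix (Fin 2) (Fin 2) ℝ).det|)⁻¹ • M, ?_, ?_⟩
  · rw [Matrix.det_smul, Fintype.card_fin, inv_pow, Real.sq_sqrt (abs_nonneg _), abs_mul, abs_inv,
      abs_abs, inv_mul_cancel₀ (abs_ne_zero.2 hM)]
  · rw [ofMat_smul (inv_ne_zero hpos.ne'), ofMat_coe]

theorem continuousOn_ofMat :
    ContinuousOn ofMat {M : Matrix (Fin 2) (Fin 2) ℝ | M.det ≠ 0} := by
  rw [continuousOn_iff_continuous_domRestrict]
  have h : Continuous fun M : {M : Matrix (Fin 2) (Fin 2) ℝ | M.det ≠ 0} =>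
      Matrix.GeneralLinearGroup.mkOfDetNeZero M.1 M.2 := by
    rw [Units.continuous_iff]
    refine ⟨continuous_subtype_val, ?_⟩
    have e : (fun M : {M : Matrix (Fin 2) (Fin 2) ℝ | M.det ≠ 0} =>
        ((Matrix.GeneralLinearGroup.mkOfDetNeZero M.1 M.2)⁻¹ : GL (Fin 2) ℝ).val)
          = fun M => (M.1)⁻¹ := by
      funext M
      rw [Matrix.coe_units_inv]
      rfl
    rw [e, continuous_iff_continuousAt]
    intro M
    refine (continuousAt_matrix_inv M.1 ?_).comp continuous_subtype_val.continuousAt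
    have : (Ring.inverse : ℝ → ℝ) = Inv.inv := Ring.inverse_eq_inv'
    rw [this]
    exact continuousAt_inv₀ M.2
  refine (isQuotientMap_mk.continuous.comp h).congr fun M => ?_
  have hM : M.1.det ≠ 0 := M.2
  change _ = ofMat M.1
  rw [ofMat, dif_pos hM]
  rfl

/-- The function on `PGL₂(ℝ)` induced by a function on matrices that is invariant under scaling. -/
def onPGL {Y : Type*} (f : Matrix (Fin 2) (Fin 2) ℝ → Y) (g : PGL(2, ℝ)) : Y :=
  f ((Function.surjInv Matrix.ProjGenLinGroup.mk_surjective g : GL (Fin 2) ℝ) :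
    Matrix (Fin 2) (Fin 2) ℝ)

theorem onPGL_ofMat {Y : Type*} {f : Matrix (Fin 2) (Fin 2) ℝ → Y}
    (hf : ∀ c : ℝ, c ≠ 0 → ∀ M, f (c • M) = f M) {M : Matrix (Fin 2) (Fin 2) ℝ} (hM : M.det ≠ 0) :
    onPGL f (ofMat M) = f M := by
  have h := Function.surjInv_eq Matrix.ProjGenLinGroup.mk_surjective (ofMat M)
  rw [← ofMat_coe] at h
  set N := Function.surjInv Matrix.ProjGenLinGroup.mk_surjective (ofMat M)
  obtain ⟨c, hc, e⟩ := (ofMat_eq_ofMat_iff (det_coe_ne_zero N) hM).1 h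
  rw [onPGL, show Function.surjInv Matrix.ProjGenLinGroup.mk_surjective (ofMat M) = N from rfl, e,
    hf c hc]

theorem continuous_onPGL {Y : Type*} [TopologicalSpace Y] {f : Matrix (Fin 2) (Fin 2) ℝ → Y}
    (hf : ∀ c : ℝ, c ≠ 0 → ∀ M, f (c • M) = f M)
    (hcont : ∀ M : Matrix (Fin 2) (Fin 2) ℝ, M.det ≠ 0 → ContinuousAt f M) :
    Continuous (onPGL f) := by
  rw [isQuotientMap_mk.continuous_iff, continuous_iff_continuousAt]
  intro M
  have hM : (M : Matrix (Fin 2) (Fin 2) ℝ).det ≠ 0 := det_coe_ne_zero M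
  have e : onPGL f ∘ Matrix.ProjGenLinGroup.mk
      = fun N : GL (Fin 2) ℝ => f (N : Matrix (Fin 2) (Fin 2) ℝ) := by
    funext N
    rw [Function.comp_apply, ← ofMat_coe, onPGL_ofMat hf (det_coe_ne_zero N)]
  rw [e]
  exact ContinuousAt.comp (f := fun N : GL (Fin 2) ℝ => (N : Matrix (Fin 2) (Fin 2) ℝ))
    (hcont M hM) Units.continuous_val.continuousAt

/-- The square of the Euclidean norm of a matrix, divided by its determinant in absolute value. -/
def matHeight (M : Matrix (Fin 2) (Fin 2) ℝ) : ℝ :=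
  (M 0 0 ^ 2 + M 0 1 ^ 2 + M 1 0 ^ 2 + M 1 1 ^ 2) / |M.det|

theorem matHeight_smul (c : ℝ) (hc : c ≠ 0) (M : Matrix (Fin 2) (Fin 2) ℝ) :
    matHeight (c • M) = matHeight M := by
  simp only [matHeight, Matrix.smul_apply, smul_eq_mul, Matrix.det_smul, Fintype.card_fin, abs_mul,
    abs_pow, sq_abs]
  rw [← mul_div_mul_left _ |M.det| (pow_ne_zero 2 hc)]
  ring

theorem continuousAt_matHeight {M : Matrix (Fin 2) (Fin 2) ℝ} (hM : M.det ≠ 0) :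
    ContinuousAt matHeight M := by
  unfold matHeight
  refine ContinuousAt.div (by fun_prop) ?_ (abs_ne_zero.2 hM)
  exact (continuous_id.matrix_det.abs).continuousAt

/-- The height of an element of `PGL₂(ℝ)`, a proper function. -/
def height : PGL(2, ℝ) → ℝ := onPGL matHeight

theorem height_ofMat {M : Matrix (Fin 2) (Fin 2) ℝ} (hM : M.det ≠ 0) :
    height (ofMat M) = matHeight M := onPGL_ofMat matHeight_smul hM

theorem continuous_height : Continuous height :=
  continuous_onPGL matHeight_smul fun _ => continuousAt_matHeight

theorem isCompact_height_le (R : ℝ) : IsCompact {g | height g ≤ R} := by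
  have hK : IsCompact {M : Matrix (Fin 2) (Fin 2) ℝ | |M.det| = 1 ∧
      M 0 0 ^ 2 + M 0 1 ^ 2 + M 1 0 ^ 2 + M 1 1 ^ 2 ≤ R} := by
    have hc : IsCompact (Set.univ.pi fun _ : Fin 2 => Set.univ.pi fun _ : Fin 2 =>
        Set.Icc (-√R) (√R)) :=
      isCompact_univ_pi fun _ => isCompact_univ_pi fun _ => isCompact_Icc
    refine IsCompact.of_isClosed_subset hc ?_ ?_
    · refine IsClosed.inter ?_ ?_
      · exact isClosed_singleton.preimage (continuous_id.matrix_det.abs)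
      · exact isClosed_le (f := fun M : Matrix (Fin 2) (Fin 2) ℝ =>
        M 0 0 ^ 2 + M 0 1 ^ 2 + M 1 0 ^ 2 + M 1 1 ^ 2) (by fun_prop) continuous_const
    · rintro M ⟨-, h⟩ i - j -
      rw [Set.mem_Icc, ← abs_le]
      refine Real.abs_le_sqrt ?_
      fin_cases i <;> fin_cases j <;> simp only [Fin.zero_eta, Fin.mk_one] <;>
        nlinarith [sq_nonneg (M 0 0), sq_nonneg (M 0 1), sq_nonneg (M 1 0), sq_nonneg (M 1 1)]
  have e : {g | height g ≤ R} = ofMat '' {M : Matrix (Fin 2) (Fin 2) ℝ | |M.det| = 1 ∧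
      M 0 0 ^ 2 + M 0 1 ^ 2 + M 1 0 ^ 2 + M 1 1 ^ 2 ≤ R} := by
    ext g
    constructor
    · intro hg
      obtain ⟨M, hM, rfl⟩ := exists_ofMat_eq g
      have hM0 : M.det ≠ 0 := fun h => by simp [h] at hM
      refine ⟨M, ⟨hM, ?_⟩, rfl⟩
      rwa [Set.mem_ofPred_eq, height_ofMat hM0, matHeight, hM, div_one] at hg
    · rintro ⟨M, ⟨hM, h⟩, rfl⟩
      have hM0 : M.det ≠ 0 := fun h => by simp [h] at hM
      rwa [Set.mem_ofPred_eq, height_ofMat hM0, matHeight, hM, div_one]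
  rw [e]
  refine hK.image_of_continuousOn (continuousOn_ofMat.mono ?_)
  rintro M ⟨hM, -⟩ h
  simp [h] at hM

instance : LocallyCompactSpace PGL(2, ℝ) := by
  have : WeaklyLocallyCompactSpace PGL(2, ℝ) := by
    refine ⟨fun g => ⟨_, isCompact_height_le (height g + 1), ?_⟩⟩
    refine mem_of_superset ((isOpen_lt continuous_height continuous_const).mem_nhds
      (lt_add_one (height g))) fun h hh => ?_
    rw [Set.mem_ofPred_eq] at hh ⊢
    exact hh.le
  infer_instance

/-! ### The lattice `PGL₂(ℤ)` -/

/-- The real matrix with the given integer entries. -/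
abbrev realMat (M : Matrix (Fin 2) (Fin 2) ℤ) : Matrix (Fin 2) (Fin 2) ℝ :=
  M.map (Int.cast : ℤ → ℝ)

theorem det_realMat (M : Matrix (Fin 2) (Fin 2) ℤ) : (realMat M).det = (M.det : ℝ) := by
  simp [Matrix.det_fin_two]

theorem abs_det_realMat {M : Matrix (Fin 2) (Fin 2) ℤ} (hM : IsUnit M.det) :
    |(realMat M).det| = 1 := by
  rw [det_realMat]
  rcases Int.isUnit_iff.1 hM with h | h <;> simp [h]

theorem det_realMat_ne_zero {M : Matrix (Fin 2) (Fin 2) ℤ} (hM : IsUnit M.det) :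
    (realMat M).det ≠ 0 := by
  intro h
  have := abs_det_realMat hM
  simp [h] at this

theorem mem_Lam_iff (g : PGL(2, ℝ)) :
    g ∈ Lam ↔ ∃ M : Matrix (Fin 2) (Fin 2) ℤ, IsUnit M.det ∧ ofMat (realMat M) = g := by
  rw [Lam, MonoidHom.mem_range]
  constructor
  · rintro ⟨M, rfl⟩
    refine ⟨M, M.det.isUnit, ?_⟩
    rw [MonoidHom.comp_apply, ← ofMat_coe]
    rfl
  · rintro ⟨M, hM, rfl⟩
    obtain ⟨N, rfl⟩ := (Matrix.isUnit_iff_isUnit_det M).2 hM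
    refine ⟨N, ?_⟩
    rw [MonoidHom.comp_apply, ← ofMat_coe]
    rfl

/-- The lattice meets every compact set in a finite set. -/
theorem finite_Lam_inter {K : Set PGL(2, ℝ)} (hK : IsCompact K) :
    {γ : Lam | (γ : PGL(2, ℝ)) ∈ K}.Finite := by
  obtain ⟨R, hR⟩ := hK.bddAbove_image continuous_height.continuousOn
  have hfin : (Set.univ.pi fun _ : Fin 2 => Set.univ.pi fun _ : Fin 2 =>
      Set.Icc (-⌈|R|⌉) ⌈|R|⌉ : Set (Fin 2 → Fin 2 → ℤ)).Finite :=
    Set.Finite.pi fun _ => Set.Finite.pi fun _ => Set.finite_Icc _ _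
  refine Set.Finite.of_finite_image (f := ((↑) : Lam → PGL(2, ℝ))) ?_
    Subtype.val_injective.injOn
  refine (hfin.image fun M => ofMat (realMat (Matrix.of M))).subset ?_
  rintro _ ⟨γ, hγ, rfl⟩
  obtain ⟨M, hM, e⟩ := (mem_Lam_iff γ).1 γ.2
  refine ⟨M, ?_, e⟩
  have h := hR ⟨_, hγ, rfl⟩
  rw [← e, height_ofMat (det_realMat_ne_zero hM), matHeight, abs_det_realMat hM, div_one] at h
  simp only [Matrix.map_apply] at h
  norm_cast at h
  rintro i - j -
  have hs : M i j ^ 2 ≤ ⌈|R|⌉ := by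
    have : ((M i j ^ 2 : ℤ) : ℝ) ≤ (⌈|R|⌉ : ℤ) := by
      refine le_trans ?_ ((le_abs_self R).trans (Int.le_ceil _))
      refine le_trans ?_ h
      norm_cast
      fin_cases i <;> fin_cases j <;> simp only [Fin.zero_eta, Fin.mk_one] <;>
        nlinarith [sq_nonneg (M 0 0), sq_nonneg (M 0 1), sq_nonneg (M 1 0), sq_nonneg (M 1 1)]
    exact_mod_cast this
  rw [Set.mem_Icc, ← abs_le]
  refine le_trans ?_ hs
  rw [← sq_abs]
  exact Int.le_self_sq _

/-! ### Automorphic sums and the Haar measure -/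

instance : ContinuousConstSMul PGL(2, ℝ) X :=
  inferInstanceAs (ContinuousConstSMul PGL(2, ℝ) (PGL(2, ℝ) ⧸ Lam))

/-- The projection `g ↦ g x₀` of `PGL₂(ℝ)` onto `X`. -/
def toX (g : PGL(2, ℝ)) : X := (g : PGL(2, ℝ) ⧸ Lam)

theorem isOpenQuotientMap_toX : IsOpenQuotientMap toX :=
  QuotientGroup.isOpenQuotientMap_mk (N := Lam)

theorem smul_toX (g h : PGL(2, ℝ)) : g • toX h = toX (g * h) := rfl

theorem smul_x₀ (g : PGL(2, ℝ)) : g • x₀ = toX g := by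
  have : x₀ = toX 1 := rfl
  rw [this, smul_toX, mul_one]

/-- The automorphic sum of a compactly supported function is locally finite. -/
theorem finite_sum_support (φ : C_c(PGL(2, ℝ), ℝ)) {K : Set PGL(2, ℝ)} (hK : IsCompact K) :
    {γ : Lam | ∃ g ∈ K, φ (g * γ) ≠ 0}.Finite := by
  refine (finite_Lam_inter (hK.inv.mul φ.hasCompactSupport)).subset ?_
  rintro γ ⟨g, hg, h⟩
  exact ⟨g⁻¹, Set.inv_mem_inv.2 hg, g * γ, subset_tsupport _ h, by group⟩

theorem finite_support (φ : C_c(PGL(2, ℝ), ℝ)) (g : PGL(2, ℝ)) :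
    (Function.support fun γ : Lam => φ (g * γ)).Finite :=
  (finite_sum_support φ (isCompact_singleton (x := g))).subset fun _ h => ⟨g, rfl, h⟩

/-- The automorphic sum `g ↦ ∑ γ ∈ Λ, φ (g γ)` of a compactly supported function, as a function
on `PGL₂(ℝ)`. -/
def autSum (φ : C_c(PGL(2, ℝ), ℝ)) (g : PGL(2, ℝ)) : ℝ := ∑ᶠ γ : Lam, φ (g * γ)

theorem autSum_mul (φ : C_c(PGL(2, ℝ), ℝ)) (g : PGL(2, ℝ)) (γ : Lam) :
    autSum φ (g * γ) = autSum φ g := by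
  rw [autSum, autSum, ← finsum_comp_equiv (Equiv.mulLeft γ) (f := fun δ : Lam => φ (g * δ))]
  simp [mul_assoc]

theorem continuous_autSum (φ : C_c(PGL(2, ℝ), ℝ)) : Continuous (autSum φ) := by
  refine continuous_finsum (fun γ => φ.continuous.comp (continuous_mul_const _)) fun g => ?_
  obtain ⟨K, hK, hg⟩ := exists_compact_mem_nhds g
  refine ⟨K, hg, (finite_sum_support φ hK).subset ?_⟩
  rintro γ ⟨h, hh, hK⟩
  exact ⟨h, hK, hh⟩

/-- Where the sum does not vanish, the point may be moved into the support of `φ` by an element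
of `Λ`, hence the sum is bounded by its maximum there. -/
theorem exists_bound_autSum (φ : C_c(PGL(2, ℝ), ℝ)) : ∃ C, ∀ g, ‖autSum φ g‖ ≤ C := by
  obtain ⟨C, hC⟩ := (φ.hasCompactSupport : IsCompact _).exists_bound_of_continuousOn
    (continuous_autSum φ).continuousOn
  refine ⟨max C 0, fun g => ?_⟩
  by_cases h : ∃ γ : Lam, φ (g * γ) ≠ 0
  · obtain ⟨γ, hγ⟩ := h
    rw [← autSum_mul φ g γ]
    exact (hC _ (subset_tsupport _ hγ)).trans (le_max_left _ _)
  · push Not at h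
    simp [autSum, h]

/-- The automorphic sum of a compactly supported function, as a function on `X`. -/
def autX (φ : C_c(PGL(2, ℝ), ℝ)) : X → ℝ :=
  Quotient.lift (s := QuotientGroup.leftRel Lam) (autSum φ) fun g h hgh => by
    rw [← QuotientGroup.leftRel_apply.1 hgh |> fun hh => autSum_mul φ g ⟨g⁻¹ * h, hh⟩]
    simp

theorem continuous_autX (φ : C_c(PGL(2, ℝ), ℝ)) : Continuous (autX φ) :=
  isOpenQuotientMap_toX.isQuotientMap.continuous_iff.2 (continuous_autSum φ)

/-- The automorphic sum of a compactly supported function, as a bounded continuous function. -/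
def autBCF (φ : C_c(PGL(2, ℝ), ℝ)) : X →ᵇ ℝ :=
  BoundedContinuousFunction.ofNormedAddCommGroup (autX φ) (continuous_autX φ)
    (exists_bound_autSum φ).choose fun x => by
      obtain ⟨g, rfl⟩ := isOpenQuotientMap_toX.surjective x
      exact (exists_bound_autSum φ).choose_spec g

theorem autBCF_toX (φ : C_c(PGL(2, ℝ), ℝ)) (g : PGL(2, ℝ)) :
    autBCF φ (toX g) = ∑ᶠ γ : Lam, φ (g * γ) := rfl

theorem autBCF_add (φ ψ : C_c(PGL(2, ℝ), ℝ)) : autBCF (φ + ψ) = autBCF φ + autBCF ψ := by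
  ext x
  obtain ⟨g, rfl⟩ := isOpenQuotientMap_toX.surjective x
  rw [BoundedContinuousFunction.add_apply, autBCF_toX, autBCF_toX, autBCF_toX,
    ← finsum_add_distrib (finite_support φ g) (finite_support ψ g)]
  rfl

theorem autBCF_smul (c : ℝ) (φ : C_c(PGL(2, ℝ), ℝ)) : autBCF (c • φ) = c • autBCF φ := by
  ext x
  obtain ⟨g, rfl⟩ := isOpenQuotientMap_toX.surjective x
  rw [BoundedContinuousFunction.smul_apply, autBCF_toX, autBCF_toX, smul_finsum]
  rfl

theorem autBCF_nonneg {φ : C_c(PGL(2, ℝ), ℝ)} (hφ : 0 ≤ φ) (x : X) : 0 ≤ autBCF φ x := by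
  obtain ⟨g, rfl⟩ := isOpenQuotientMap_toX.surjective x
  exact finsum_nonneg fun γ => hφ _

theorem le_autBCF {φ : C_c(PGL(2, ℝ), ℝ)} (hφ : 0 ≤ φ) (g : PGL(2, ℝ)) :
    φ g ≤ autBCF φ (toX g) := by
  rw [autBCF_toX]
  have h := single_le_finsum (1 : Lam) (finite_support φ g) fun γ => hφ (g * γ)
  simpa using h

/-- The left translate `h ↦ φ (g h)` of a compactly supported function. -/
def leftTranslate (g : PGL(2, ℝ)) (φ : C_c(PGL(2, ℝ), ℝ)) : C_c(PGL(2, ℝ), ℝ) :=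
  ⟨⟨fun h => φ (g * h), φ.continuous.comp (continuous_const_mul g)⟩,
    φ.hasCompactSupport.comp_homeomorph (Homeomorph.mulLeft g)⟩

theorem leftTranslate_apply (g h : PGL(2, ℝ)) (φ : C_c(PGL(2, ℝ), ℝ)) :
    leftTranslate g φ h = φ (g * h) := rfl

theorem autBCF_leftTranslate (g : PGL(2, ℝ)) (φ : C_c(PGL(2, ℝ), ℝ)) (x : X) :
    autBCF (leftTranslate g φ) x = autBCF φ (g • x) := by
  obtain ⟨h, rfl⟩ := isOpenQuotientMap_toX.surjective x
  rw [smul_toX, autBCF_toX, autBCF_toX]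
  simp only [leftTranslate_apply, mul_assoc]

section Measure

variable (m : Measure X) [IsProbabilityMeasure m]

/-- The positive functional `φ ↦ ∫ ∑ γ ∈ Λ, φ (g γ) dm(gΛ)`. -/
def autFunctional : C_c(PGL(2, ℝ), ℝ) →ₚ[ℝ] ℝ :=
  PositiveLinearMap.mk₀
    { toFun := fun φ => ∫ x, autBCF φ x ∂m
      map_add' := fun φ ψ => by
        rw [autBCF_add]
        exact integral_add ((autBCF φ).integrable m) ((autBCF ψ).integrable m)
      map_smul' := fun c φ => by
        rw [autBCF_smul]
        exact integral_smul c _ }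
    fun _ hφ => integral_nonneg (autBCF_nonneg hφ)

theorem autFunctional_apply (φ : C_c(PGL(2, ℝ), ℝ)) :
    autFunctional m φ = ∫ x, autBCF φ x ∂m := rfl

/-- A `PGL₂(ℝ)`-invariant probability measure on `X` lifts to a left-invariant measure. -/
theorem isMulLeftInvariant_rieszMeasure [SMulInvariantMeasure PGL(2, ℝ) X m] :
    (RealRMK.rieszMeasure (autFunctional m)).IsMulLeftInvariant := by
  refine ⟨fun g => ?_⟩
  have hreg : (Measure.map (fun h => g * h) (RealRMK.rieszMeasure (autFunctional m))).Regular :=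
    Measure.Regular.map (Homeomorph.mulLeft g)
  refine Measure.ext_of_integral_eq_on_compactlySupported fun φ => ?_
  rw [integral_map (measurable_const_mul g).aemeasurable (map_continuous φ).aestronglyMeasurable]
  change ∫ h, leftTranslate g φ h ∂_ = _
  rw [RealRMK.integral_rieszMeasure, RealRMK.integral_rieszMeasure, autFunctional_apply,
    autFunctional_apply]
  simp only [autBCF_leftTranslate]
  exact integral_smul_eq_self (fun x => autBCF φ x)

/-- The functional does not vanish: some compact set has an image of positive measure. -/
theorem exists_autFunctional_pos : ∃ φ : C_c(PGL(2, ℝ), ℝ), 0 < autFunctional m φ := by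
  have hU : ⋃ n : ℕ, toX '' {g | height g ≤ n} = Set.univ := by
    rw [Set.eq_univ_iff_forall]
    intro x
    obtain ⟨g, rfl⟩ := isOpenQuotientMap_toX.surjective x
    obtain ⟨n, hn⟩ := exists_nat_ge (height g)
    exact Set.mem_iUnion.2 ⟨n, g, hn, rfl⟩
  obtain ⟨n, hn⟩ : ∃ n : ℕ, m (toX '' {g | height g ≤ n}) ≠ 0 := by
    by_contra h
    push Not at h
    have := measure_iUnion_null h
    rw [hU, measure_univ] at this
    exact one_ne_zero this
  obtain ⟨f, hf1, -, hfc, hf01⟩ := exists_continuous_one_zero_of_isCompact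
    (isCompact_height_le (n : ℝ)) isClosed_empty (Set.disjoint_empty _)
  let φ : C_c(PGL(2, ℝ), ℝ) := ⟨f, hfc⟩
  have hφ : 0 ≤ φ := fun g => (hf01 g).1
  refine ⟨φ, ?_⟩
  rw [autFunctional_apply, integral_pos_iff_support_of_nonneg (autBCF_nonneg hφ)
    ((autBCF φ).integrable m)]
  refine (pos_iff_ne_zero.2 hn).trans_le (measure_mono ?_)
  rintro _ ⟨g, hg, rfl⟩
  have h1 : φ g = 1 := hf1 hg
  have := le_autBCF hφ g
  rw [h1] at this
  exact (zero_lt_one.trans_le this).ne'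

/-- The unfolding formula: the integral of an automorphic sum against an invariant probability
measure on `X` is a positive multiple of the Haar integral. -/
theorem exists_integral_autBCF_eq [SMulInvariantMeasure PGL(2, ℝ) X m]
    (μ : Measure PGL(2, ℝ)) [μ.IsHaarMeasure] :
    ∃ c : ℝ, 0 < c ∧ ∀ φ : C_c(PGL(2, ℝ), ℝ), ∫ x, autBCF φ x ∂m = c * ∫ g, φ g ∂μ := by
  have := isMulLeftInvariant_rieszMeasure m
  let ν := RealRMK.rieszMeasure (autFunctional m)
  have key : ∀ φ : C_c(PGL(2, ℝ), ℝ),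
      ∫ x, autBCF φ x ∂m = (Measure.haarScalarFactor ν μ : ℝ) * ∫ g, φ g ∂μ := by
    intro φ
    rw [← autFunctional_apply, ← RealRMK.integral_rieszMeasure,
      Measure.integral_isMulLeftInvariant_eq_smul_of_hasCompactSupport ν μ (map_continuous φ)
        φ.hasCompactSupport, integral_smul_nnreal_measure]
    rfl
  refine ⟨_, ?_, key⟩
  refine lt_of_le_of_ne NNReal.zero_le_coe fun h => ?_
  obtain ⟨φ, hφ⟩ := exists_autFunctional_pos m
  rw [autFunctional_apply, key, ← h, zero_mul] at hφ
  exact lt_irrefl _ hφ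

end Measure

/-! ### An explicit Haar measure on `PGL₂(ℝ)` -/

/-- The matrix with the given pair of columns. -/
def colMat (p : (Fin 2 → ℝ) × (Fin 2 → ℝ)) : Matrix (Fin 2) (Fin 2) ℝ :=
  !![p.1 0, p.2 0; p.1 1, p.2 1]

theorem det_colMat (p : (Fin 2 → ℝ) × (Fin 2 → ℝ)) :
    (colMat p).det = p.1 0 * p.2 1 - p.2 0 * p.1 1 := by
  rw [colMat, Matrix.det_fin_two_of]

theorem continuous_colMat : Continuous colMat := by
  refine continuous_matrix fun i j => ?_
  fin_cases i <;> fin_cases j <;> simp [colMat] <;> fun_prop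

theorem continuous_det_colMat : Continuous fun p => (colMat p).det :=
  continuous_colMat.matrix_det

/-- The set of nonsingular matrices of determinant at most `1` in absolute value, the truncated
cone over the matrices of determinant `±1`. -/
def detCone : Set ((Fin 2 → ℝ) × (Fin 2 → ℝ)) := {p | (colMat p).det ≠ 0 ∧ |(colMat p).det| ≤ 1}

theorem measurableSet_detCone : MeasurableSet detCone :=
  (isOpen_ne_fun continuous_det_colMat continuous_const).measurableSet.inter
    (isClosed_le continuous_det_colMat.abs continuous_const).measurableSet

theorem measurable_ofMat_colMat : Measurable fun p => ofMat (colMat p) := by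
  classical
  have hs : MeasurableSet {p | (colMat p).det ≠ 0} :=
    (isOpen_ne_fun continuous_det_colMat continuous_const).measurableSet
  have hc : ContinuousOn (fun p => ofMat (colMat p)) {p | (colMat p).det ≠ 0} :=
    continuousOn_ofMat.comp continuous_colMat.continuousOn fun _ hp => hp
  have h := hc.measurable_piecewise (continuousOn_const (c := (1 : PGL(2, ℝ)))) hs
  convert h using 1
  funext p
  by_cases hp : p ∈ {p | (colMat p).det ≠ 0}
  · rw [Set.piecewise_eq_of_mem _ _ _ hp]
  · rw [Set.piecewise_eq_of_notMem _ _ _ hp, ofMat, dif_neg (Set.notMem_ofPred_iff.1 hp)]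

/-- An explicit Haar measure on `PGL₂(ℝ)`: a set is measured by the volume of the part of the cone
over it where the determinant is at most `1` in absolute value. -/
def haarPGL : Measure PGL(2, ℝ) :=
  Measure.map (fun p => ofMat (colMat p)) (volume.restrict detCone)

/-- The action of a matrix on pairs of columns. -/
def colAct (M : Matrix (Fin 2) (Fin 2) ℝ) (p : (Fin 2 → ℝ) × (Fin 2 → ℝ)) :
    (Fin 2 → ℝ) × (Fin 2 → ℝ) := (Matrix.toLin' M p.1, Matrix.toLin' M p.2)

theorem colMat_colAct (M : Matrix (Fin 2) (Fin 2) ℝ) (p : (Fin 2 → ℝ) × (Fin 2 → ℝ)) :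
    colMat (colAct M p) = M * colMat p := by
  ext i j
  fin_cases i <;> fin_cases j <;>
    simp [colMat, colAct, Matrix.mul_apply, Fin.sum_univ_two]

theorem measurePreserving_colAct {M : Matrix (Fin 2) (Fin 2) ℝ} (hM : |M.det| = 1) :
    MeasurePreserving (colAct M) volume volume := by
  have hM0 : M.det ≠ 0 := fun h => by simp [h] at hM
  have h : MeasurePreserving (Matrix.toLin' M : (Fin 2 → ℝ) → (Fin 2 → ℝ)) volume volume := by
    refine ⟨(LinearMap.continuous_of_finiteDimensional _).measurable, ?_⟩
    rw [Real.map_matrix_volume_pi_eq_smul_volume_pi hM0, abs_inv, hM]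
    simp
  exact h.prod h

instance : haarPGL.IsMulLeftInvariant := by
  refine ⟨fun g => ?_⟩
  obtain ⟨M, hM, rfl⟩ := exists_ofMat_eq g
  have hM0 : M.det ≠ 0 := fun h => by simp [h] at hM
  have hpre : colAct M ⁻¹' detCone = detCone := by
    ext p
    simp only [detCone, Set.mem_preimage, Set.mem_ofPred_eq, colMat_colAct, Matrix.det_mul, abs_mul,
      hM, one_mul, mul_ne_zero_iff, ne_eq, hM0, not_false_eq_true, true_and]
  have hT : MeasurePreserving (colAct M) (volume.restrict detCone) (volume.restrict detCone) := by
    have := (measurePreserving_colAct hM).restrict_preimage measurableSet_detCone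
    rwa [hpre] at this
  calc Measure.map (fun h => ofMat M * h) haarPGL
      = Measure.map ((fun h => ofMat M * h) ∘ fun p => ofMat (colMat p))
          (volume.restrict detCone) := by
        rw [haarPGL, Measure.map_map (measurable_const_mul _) measurable_ofMat_colMat]
    _ = Measure.map ((fun p => ofMat (colMat p)) ∘ colAct M) (volume.restrict detCone) := by
        refine Measure.map_congr ?_
        filter_upwards [ae_restrict_mem measurableSet_detCone] with p hp
        simp only [Function.comp_apply, colMat_colAct, ofMat_mul hM0 hp.1]
    _ = haarPGL := by
        rw [← Measure.map_map measurable_ofMat_colMat hT.measurable, hT.map_eq, haarPGL]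

theorem haarPGL_height_le_lt_top (R : ℝ) : haarPGL {g | height g ≤ R} < ⊤ := by
  have hc : IsCompact ((Set.univ.pi fun _ : Fin 2 => Set.Icc (-√|R|) (√|R|)) ×ˢ
      (Set.univ.pi fun _ : Fin 2 => Set.Icc (-√|R|) (√|R|))) :=
    (isCompact_univ_pi fun _ => isCompact_Icc).prod (isCompact_univ_pi fun _ => isCompact_Icc)
  rw [haarPGL, Measure.map_apply measurable_ofMat_colMat
    (isCompact_height_le R).isClosed.measurableSet,
    Measure.restrict_apply (measurable_ofMat_colMat
      (isCompact_height_le R).isClosed.measurableSet)]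
  refine (measure_mono ?_).trans_lt hc.measure_lt_top
  rintro p ⟨hp, hp0, hp1⟩
  have hp : height (ofMat (colMat p)) ≤ R := hp
  rw [height_ofMat hp0, matHeight, div_le_iff₀ (abs_pos.2 hp0)] at hp
  have hp2 : p.1 0 ^ 2 + p.2 0 ^ 2 + p.1 1 ^ 2 + p.2 1 ^ 2 ≤ |R| := by
    have h1 : R * |(colMat p).det| ≤ |R| := by
      refine (mul_le_mul_of_nonneg_right (le_abs_self R) (abs_nonneg _)).trans ?_
      exact mul_le_of_le_one_right (abs_nonneg _) hp1
    refine le_trans (le_of_eq ?_) (hp.trans h1)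
    simp [colMat]
  constructor
  · rintro i -
    rw [Set.mem_Icc, ← abs_le]
    refine Real.abs_le_sqrt ?_
    fin_cases i <;> simp only [Fin.zero_eta, Fin.mk_one] <;>
      nlinarith [sq_nonneg (p.1 0), sq_nonneg (p.2 0), sq_nonneg (p.1 1), sq_nonneg (p.2 1)]
  · rintro i -
    rw [Set.mem_Icc, ← abs_le]
    refine Real.abs_le_sqrt ?_
    fin_cases i <;> simp only [Fin.zero_eta, Fin.mk_one] <;>
      nlinarith [sq_nonneg (p.1 0), sq_nonneg (p.2 0), sq_nonneg (p.1 1), sq_nonneg (p.2 1)]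

instance : haarPGL.IsHaarMeasure := by
  have h1 : height (ofMat (1 : Matrix (Fin 2) (Fin 2) ℝ)) = 2 := by
    rw [height_ofMat (by simp)]
    simp [matHeight]
    norm_num
  have hop : IsOpen {g | height g < 3} := isOpen_lt continuous_height continuous_const
  have hsub : {g | height g < 3} ⊆ {g | height g ≤ 3} := fun g hg => le_of_lt (α := ℝ) hg
  refine Measure.isHaarMeasure_of_isCompact_nonempty_interior haarPGL {g | height g ≤ 3}
    (isCompact_height_le 3) ⟨ofMat 1, ?_⟩ ?_ (haarPGL_height_le_lt_top 3).ne
  · refine interior_maximal hsub hop ?_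
    rw [Set.mem_ofPred_eq, h1]
    norm_num
  · -- the matrices near a small multiple of the identity have small height and determinant
    refine (lt_of_lt_of_le ?_ (measure_mono hsub)).ne'
    rw [haarPGL, Measure.map_apply measurable_ofMat_colMat hop.measurableSet,
      Measure.restrict_apply (measurable_ofMat_colMat hop.measurableSet)]
    have hU : IsOpen {p | (colMat p).det ≠ 0} := isOpen_ne_fun continuous_det_colMat continuous_const
    have hV : IsOpen ({p | (colMat p).det ≠ 0} ∩
        (fun p => ofMat (colMat p)) ⁻¹' {g | height g < 3}) :=
      (continuousOn_ofMat.comp continuous_colMat.continuousOn fun _ hp => hp).isOpen_inter_preimage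
        hU hop
    have hW : IsOpen {p | |(colMat p).det| < 1} := isOpen_lt continuous_det_colMat.abs
      continuous_const
    refine ((hV.inter hW).measure_pos volume ⟨(![1 / 2, 0], ![0, 1 / 2]), ?_⟩).trans_le
      (measure_mono ?_)
    · have e : colMat (![1 / 2, 0], ![0, 1 / 2]) = (1 / 2 : ℝ) • 1 := by
        ext i j
        fin_cases i <;> fin_cases j <;> simp [colMat]
      have hd : ((1 / 2 : ℝ) • (1 : Matrix (Fin 2) (Fin 2) ℝ)).det = 1 / 4 := by
        rw [Matrix.det_smul]
        simp
        norm_num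
      refine ⟨⟨?_, ?_⟩, ?_⟩
      · rw [Set.mem_ofPred_eq, e, hd]
        norm_num
      · rw [Set.mem_preimage, e, ofMat_smul (by norm_num), Set.mem_ofPred_eq, h1]
        norm_num
      · rw [Set.mem_ofPred_eq, e, hd]
        norm_num [abs_of_pos]
    · rintro p ⟨⟨h1, h2⟩, h3⟩
      exact ⟨h2, h1, le_of_lt (α := ℝ) h3⟩

/-! ### Test functions on `PGL₂(ℝ)` -/

/-- The tent function `s ↦ max (1 - |s|) 0`, a continuous bump of integral one. -/
def tent (s : ℝ) : ℝ := max (1 - |s|) 0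

theorem continuous_tent : Continuous tent := by unfold tent; fun_prop

theorem tent_nonneg (s : ℝ) : 0 ≤ tent s := le_max_right _ _

theorem abs_lt_one_of_tent_ne_zero {s : ℝ} (h : tent s ≠ 0) : |s| < 1 := by
  by_contra hs
  exact h (max_eq_right (by linarith))

/-- The function `ψ(-B / A, C / D) · tent(½ log (|det| / D²))` of a matrix `(A, B; C, D)`. The first
two coordinates are constant along the orbits of `t ↦ a t`, and the argument of the tent function is
the time along such an orbit. -/
def testMat (ψ : ℝ × ℝ → ℝ) (M : Matrix (Fin 2) (Fin 2) ℝ) : ℝ :=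
  ψ (-M 0 1 / M 0 0, M 1 0 / M 1 1) * tent (1 / 2 * Real.log (|M.det| / M 1 1 ^ 2))

theorem testMat_smul (ψ : ℝ × ℝ → ℝ) (c : ℝ) (hc : c ≠ 0) (M : Matrix (Fin 2) (Fin 2) ℝ) :
    testMat ψ (c • M) = testMat ψ M := by
  simp only [testMat, Matrix.smul_apply, smul_eq_mul, Matrix.det_smul, Fintype.card_fin, abs_mul,
    abs_pow, sq_abs]
  rw [mul_div_mul_left _ _ hc, mul_pow, mul_div_mul_left _ _ (pow_ne_zero 2 hc), ← mul_neg,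
    mul_div_mul_left _ _ hc]

/-- The weight functions on the natural extension: nonnegative continuous functions that vanish
off the open unit square. -/
structure IsWeight (ψ : ℝ × ℝ → ℝ) : Prop where
  continuous : Continuous ψ
  nonneg : ∀ z, 0 ≤ ψ z
  mem : ∀ z, ψ z ≠ 0 → z.1 ∈ Set.Ioo (0 : ℝ) 1 ∧ z.2 ∈ Set.Ioo (0 : ℝ) 1

/-- On the support of a test function the matrix has the form `(A, -xA; yD, D)` with
`x, y ∈ (0, 1)`. -/
theorem exists_of_mem_weight {M : Matrix (Fin 2) (Fin 2) ℝ}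
    (hx : -M 0 1 / M 0 0 ∈ Set.Ioo (0 : ℝ) 1) (hy : M 1 0 / M 1 1 ∈ Set.Ioo (0 : ℝ) 1) :
    M 0 0 ≠ 0 ∧ M 1 1 ≠ 0 ∧ |M 0 1| ≤ |M 0 0| ∧ |M 1 0| ≤ |M 1 1| ∧
      |M 0 0| * |M 1 1| ≤ |M.det| := by
  have hA : M 0 0 ≠ 0 := fun h => by simp [h] at hx
  have hD : M 1 1 ≠ 0 := fun h => by simp [h] at hy
  have h1 : |M 0 1| ≤ |M 0 0| := by
    have := abs_of_pos hx.1 ▸ hx.2.le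
    rwa [abs_div, abs_neg, div_le_one (abs_pos.2 hA)] at this
  have h2 : |M 1 0| ≤ |M 1 1| := by
    have := abs_of_pos hy.1 ▸ hy.2.le
    rwa [abs_div, div_le_one (abs_pos.2 hD)] at this
  refine ⟨hA, hD, h1, h2, ?_⟩
  have e : M.det = M 0 0 * M 1 1 * (1 + -M 0 1 / M 0 0 * (M 1 0 / M 1 1)) := by
    rw [Matrix.det_fin_two]
    field_simp
    ring
  have h3 : 0 < -M 0 1 / M 0 0 * (M 1 0 / M 1 1) := mul_pos hx.1 hy.1
  rw [e, abs_mul, abs_mul, abs_of_pos (by linarith : 0 < 1 + -M 0 1 / M 0 0 * (M 1 0 / M 1 1))]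
  exact le_mul_of_one_le_right (by positivity) (by linarith)

theorem continuousAt_testMat {ψ : ℝ × ℝ → ℝ} (hψ : IsWeight ψ)
    {M : Matrix (Fin 2) (Fin 2) ℝ} (hM : M.det ≠ 0) : ContinuousAt (testMat ψ) M := by
  have hent : ∀ i j, Continuous fun N : Matrix (Fin 2) (Fin 2) ℝ => N i j := fun i j => by fun_prop
  have hzero : ∀ N : Matrix (Fin 2) (Fin 2) ℝ, (|N 0 0| < |N 0 1| ∨ |N 1 1| < |N 1 0|) →
      testMat ψ N = 0 := by
    intro N hN
    by_contra h
    have h1 := hψ.mem _ (left_ne_zero_of_mul h)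
    obtain ⟨-, -, h2, h3, -⟩ := exists_of_mem_weight h1.1 h1.2
    rcases hN with hN | hN <;> linarith
  -- the function vanishes near the matrices where one of the two quotients is not defined
  by_cases hA : M 0 0 = 0
  · have hB : M 0 1 ≠ 0 := fun h => hM (by rw [Matrix.det_fin_two, hA, h]; ring)
    have hev : ∀ᶠ N : Matrix (Fin 2) (Fin 2) ℝ in 𝓝 M, |N 0 0| < |N 0 1| :=
      ((hent 0 0).abs.tendsto M).eventually_lt ((hent 0 1).abs.tendsto M)
        (by rw [hA, abs_zero]; exact abs_pos.2 hB)
    refine (continuousAt_const (y := (0 : ℝ))).congr ?_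
    filter_upwards [hev] with N hN
    exact (hzero N (Or.inl hN)).symm
  by_cases hD : M 1 1 = 0
  · have hC : M 1 0 ≠ 0 := fun h => hM (by rw [Matrix.det_fin_two, hD, h]; ring)
    have hev : ∀ᶠ N : Matrix (Fin 2) (Fin 2) ℝ in 𝓝 M, |N 1 1| < |N 1 0| :=
      ((hent 1 1).abs.tendsto M).eventually_lt ((hent 1 0).abs.tendsto M)
        (by rw [hD, abs_zero]; exact abs_pos.2 hC)
    refine (continuousAt_const (y := (0 : ℝ))).congr ?_
    filter_upwards [hev] with N hN
    exact (hzero N (Or.inr hN)).symm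
  · unfold testMat
    refine ContinuousAt.mul ?_ ?_
    · refine ContinuousAt.comp (g := ψ) hψ.continuous.continuousAt ?_
      exact (((hent 0 1).neg.continuousAt).div (hent 0 0).continuousAt hA).prodMk
        (((hent 1 0).continuousAt).div (hent 1 1).continuousAt hD)
    · refine ContinuousAt.comp (g := tent) continuous_tent.continuousAt ?_
      refine continuousAt_const.mul (ContinuousAt.log ?_ ?_)
      · exact (continuous_id.matrix_det.abs.continuousAt).div ((hent 1 1).pow 2).continuousAt
          (pow_ne_zero 2 hD)
      · exact div_ne_zero (abs_ne_zero.2 hM) (pow_ne_zero 2 hD)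

theorem matHeight_le_of_testMat_ne_zero {ψ : ℝ × ℝ → ℝ} (hψ : IsWeight ψ)
    {M : Matrix (Fin 2) (Fin 2) ℝ} (hM : M.det ≠ 0) (h : testMat ψ M ≠ 0) :
    matHeight M ≤ 4 * Real.exp 2 := by
  have h1 := hψ.mem _ (left_ne_zero_of_mul h)
  have h2 := abs_lt_one_of_tent_ne_zero (right_ne_zero_of_mul h)
  obtain ⟨hA, hD, hB, hC, hdet⟩ := exists_of_mem_weight h1.1 h1.2
  have hd : 0 < |M.det| := abs_pos.2 hM
  have hD2 : 0 < M 1 1 ^ 2 := by positivity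
  obtain ⟨h3, h4⟩ := abs_lt.1 h2
  have hr : 0 < |M.det| / M 1 1 ^ 2 := div_pos hd hD2
  have h5 : |M.det| ≤ Real.exp 2 * M 1 1 ^ 2 := by
    rw [← div_le_iff₀ hD2, ← Real.log_le_iff_le_exp hr]
    linarith
  have h6 : M 1 1 ^ 2 ≤ Real.exp 2 * |M.det| := by
    have : Real.exp (-2) ≤ |M.det| / M 1 1 ^ 2 := by
      rw [← Real.le_log_iff_exp_le hr]
      linarith
    rw [le_div_iff₀ hD2, Real.exp_neg, inv_mul_le_iff₀ (Real.exp_pos 2)] at this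
    exact this
  have h7 : M 0 0 ^ 2 ≤ Real.exp 2 * |M.det| := by
    have e1 : M 0 0 ^ 2 * M 1 1 ^ 2 ≤ |M.det| * |M.det| := by
      rw [← sq_abs (M 0 0), ← sq_abs (M 1 1), ← mul_pow, ← sq]
      exact pow_le_pow_left₀ (by positivity) hdet 2
    have e2 : |M.det| * |M.det| ≤ Real.exp 2 * |M.det| * M 1 1 ^ 2 := by nlinarith
    exact le_of_mul_le_mul_right (e1.trans e2) hD2
  have h8 : M 0 1 ^ 2 ≤ M 0 0 ^ 2 := sq_le_sq.2 hB
  have h9 : M 1 0 ^ 2 ≤ M 1 1 ^ 2 := sq_le_sq.2 hC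
  rw [matHeight, div_le_iff₀ hd]
  nlinarith

/-- The compactly supported function on `PGL₂(ℝ)` given by `testMat ψ`. -/
def testFun {ψ : ℝ × ℝ → ℝ} (hψ : IsWeight ψ) : C_c(PGL(2, ℝ), ℝ) :=
  ⟨⟨onPGL (testMat ψ), continuous_onPGL (testMat_smul ψ) fun _ => continuousAt_testMat hψ⟩, by
    refine HasCompactSupport.intro (isCompact_height_le (4 * Real.exp 2)) fun g hg => ?_
    obtain ⟨M, hM, rfl⟩ := exists_ofMat_eq g
    have hM0 : M.det ≠ 0 := fun h => by simp [h] at hM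
    rw [Set.mem_ofPred_eq, height_ofMat hM0] at hg
    by_contra h
    exact hg (matHeight_le_of_testMat_ne_zero hψ hM0 fun h0 =>
      h ((onPGL_ofMat (testMat_smul ψ) hM0).trans h0))⟩

theorem testFun_ofMat {ψ : ℝ × ℝ → ℝ} (hψ : IsWeight ψ) {M : Matrix (Fin 2) (Fin 2) ℝ}
    (hM : M.det ≠ 0) : testFun hψ (ofMat M) = testMat ψ M :=
  onPGL_ofMat (testMat_smul ψ) hM

theorem testFun_nonneg {ψ : ℝ × ℝ → ℝ} (hψ : IsWeight ψ) (g : PGL(2, ℝ)) : 0 ≤ testFun hψ g := by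
  obtain ⟨M, hM, rfl⟩ := exists_ofMat_eq g
  have hM0 : M.det ≠ 0 := fun h => by simp [h] at hM
  rw [testFun_ofMat hψ hM0]
  exact mul_nonneg (hψ.nonneg _) (tent_nonneg _)

/-! ### The Haar integral of the test functions -/

theorem lintegral_comp_mul_left_eq {f : ℝ → ENNReal} (hf : Measurable f) {c : ℝ} (hc : c ≠ 0) :
    ∫⁻ x, f (c * x) = ENNReal.ofReal |c⁻¹| * ∫⁻ x, f x := by
  rw [← lintegral_map hf (measurable_const_mul c), Real.map_volume_mul_left hc,
    lintegral_smul_measure, smul_eq_mul]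

theorem lintegral_eq_mul_comp_mul_left {f : ℝ → ENNReal} (hf : Measurable f) {c : ℝ} (hc : c ≠ 0) :
    ∫⁻ x, f x = ENNReal.ofReal |c| * ∫⁻ x, f (c * x) := by
  rw [lintegral_comp_mul_left_eq hf hc, ← mul_assoc, ← ENNReal.ofReal_mul (abs_nonneg _), abs_inv,
    mul_inv_cancel₀ (abs_ne_zero.2 hc), ENNReal.ofReal_one, one_mul]

theorem lintegral_eq_mul_comp_mul_left_prod {f : ℝ × ℝ → ENNReal} (hf : Measurable f) {c d : ℝ}
    (hc : c ≠ 0) (hd : d ≠ 0) :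
    ∫⁻ z, f z = ENNReal.ofReal (|c| * |d|) * ∫⁻ z : ℝ × ℝ, f (c * z.1, d * z.2) := by
  have hf2 : Measurable fun z : ℝ × ℝ => f (c * z.1, d * z.2) := hf.comp (by fun_prop)
  rw [Measure.volume_eq_prod, lintegral_prod _ hf.aemeasurable, lintegral_prod _ hf2.aemeasurable,
    lintegral_eq_mul_comp_mul_left (hf.lintegral_prod_right') hc, ENNReal.ofReal_mul (abs_nonneg _),
    mul_assoc, ← lintegral_const_mul' (ENNReal.ofReal |d|) _ ENNReal.ofReal_ne_top]
  congr 1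
  refine lintegral_congr fun x => ?_
  exact lintegral_eq_mul_comp_mul_left (hf.comp (by fun_prop)) hd

theorem lintegral_comp_mul_left_fst {f : ℝ × ℝ → ENNReal} (hf : Measurable f) {c : ℝ}
    (hc : c ≠ 0) :
    ∫⁻ z : ℝ × ℝ, f (c * z.1, z.2) = ENNReal.ofReal |c⁻¹| * ∫⁻ z, f z := by
  have h := lintegral_eq_mul_comp_mul_left_prod (hf.comp (g := f)
    (f := fun z : ℝ × ℝ => (c * z.1, z.2)) (by fun_prop)) (inv_ne_zero hc) one_ne_zero
  simpa [mul_inv_cancel_left₀ hc] using h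

/-- Integration over a matrix `(A, B; C, D)`, taken over the diagonal `(A, D)` first and the
antidiagonal `(C, B)` second. -/
theorem lintegral_columns (f : ℝ × ℝ → ℝ × ℝ → ENNReal)
    (hf : Measurable (Function.uncurry f)) :
    ∫⁻ p : (Fin 2 → ℝ) × (Fin 2 → ℝ), f (p.1 0, p.2 1) (p.1 1, p.2 0)
      = ∫⁻ P, ∫⁻ Q, f P Q := by
  have h1 := (volume_preserving_finTwoArrow ℝ).prod (volume_preserving_finTwoArrow ℝ)
  have hm : Measurable fun q : (ℝ × ℝ) × (ℝ × ℝ) => f (q.1.1, q.2.2) (q.1.2, q.2.1) :=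
    hf.comp (f := fun q : (ℝ × ℝ) × (ℝ × ℝ) => ((q.1.1, q.2.2), (q.1.2, q.2.1))) (by fun_prop)
  have e1 : ∫⁻ p : (Fin 2 → ℝ) × (Fin 2 → ℝ), f (p.1 0, p.2 1) (p.1 1, p.2 0)
      = ∫⁻ q : (ℝ × ℝ) × (ℝ × ℝ), f (q.1.1, q.2.2) (q.1.2, q.2.1) := h1.lintegral_comp hm
  rw [e1, Measure.volume_eq_prod, lintegral_prod _ hm.aemeasurable, Measure.volume_eq_prod ℝ ℝ,
    lintegral_prod _ hm.lintegral_prod_right'.aemeasurable,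
    lintegral_prod _ hf.lintegral_prod_right.aemeasurable]
  refine lintegral_congr fun A => ?_
  calc ∫⁻ C, ∫⁻ Q : ℝ × ℝ, f (A, Q.2) (C, Q.1) ∂(volume.prod volume)
      = ∫⁻ C, ∫⁻ D, ∫⁻ B, f (A, D) (C, B) := by
        refine lintegral_congr fun C => lintegral_prod_symm _ ?_
        exact (hm.comp (measurable_prodMk_left (x := (A, C)))).aemeasurable
    _ = ∫⁻ D, ∫⁻ C, ∫⁻ B, f (A, D) (C, B) := by
        refine lintegral_lintegral_swap (Measurable.aemeasurable ?_)
        exact Measurable.lintegral_prod_right' (f := fun w : (ℝ × ℝ) × ℝ =>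
          f (A, w.1.2) (w.1.1, w.2)) (hf.comp (f := fun w : (ℝ × ℝ) × ℝ =>
            ((A, w.1.2), (w.1.1, w.2))) (by fun_prop))
    _ = ∫⁻ D, ∫⁻ Q : ℝ × ℝ, f (A, D) Q ∂(volume.prod volume) := by
        refine lintegral_congr fun D => (lintegral_prod _ ?_).symm
        exact (hf.comp measurable_prodMk_left).aemeasurable

/-- The factor of the Haar integral of a test function that does not depend on the weight, as a
function of the diagonal `(A, D)`: the Jacobian `|A D|`, the truncation `0 < |A D| ≤ 1`, and the
tent function. -/
def diagWeight (P : ℝ × ℝ) : ENNReal :=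
  ENNReal.ofReal (|P.1| * |P.2|) * ({s : ℝ | s ≠ 0 ∧ |s| ≤ 1}.indicator 1 (P.1 * P.2) *
    ENNReal.ofReal (tent (1 / 2 * Real.log (|P.1| / |P.2|))))

theorem measurableSet_punctured : MeasurableSet {s : ℝ | s ≠ 0 ∧ |s| ≤ 1} :=
  (isOpen_ne_fun continuous_id continuous_const).measurableSet.inter
    (isClosed_le continuous_abs continuous_const).measurableSet

theorem measurable_tent_log {Y : Type*} [MeasurableSpace Y] {f : Y → ℝ} (hf : Measurable f) :
    Measurable fun y => tent (1 / 2 * Real.log (f y)) :=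
  continuous_tent.measurable.comp ((Real.measurable_log.comp hf).const_mul _)

theorem measurable_diagWeight : Measurable diagWeight := by
  unfold diagWeight
  refine Measurable.mul (by fun_prop) (Measurable.mul ?_ ?_)
  · exact (measurable_one.indicator measurableSet_punctured).comp (by fun_prop)
  · exact (measurable_tent_log (by fun_prop)).ennreal_ofReal

/-- The Haar integral of a test function. The substitution `B = -x A`, `C = y D` has Jacobian `|A D|`
and turns the determinant into `(1 + x y) A D`. Rescaling `A` by `1 + x y` then separates the
variables; the differential `dA` and the factor `|A D|` each contribute a factor `(1 + x y)⁻¹`. -/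
theorem lintegral_testFun {ψ : ℝ × ℝ → ℝ} (hψ : IsWeight ψ) :
    ∫⁻ g, ENNReal.ofReal (testFun hψ g) ∂haarPGL
      = (∫⁻ P, diagWeight P) * ∫⁻ z : ℝ × ℝ, ENNReal.ofReal (ψ z / (1 + z.1 * z.2) ^ 2) := by
  -- the integrand in terms of the diagonal `(A, D)` and the antidiagonal `(C, B)`
  let F : ℝ × ℝ → ℝ × ℝ → ENNReal := fun P Q =>
    {s : ℝ | s ≠ 0 ∧ |s| ≤ 1}.indicator 1 (P.1 * P.2 - Q.2 * Q.1) *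
      ENNReal.ofReal (ψ (-Q.2 / P.1, Q.1 / P.2) *
        tent (1 / 2 * Real.log (|P.1 * P.2 - Q.2 * Q.1| / P.2 ^ 2)))
  have hF : Measurable (Function.uncurry F) := by
    refine Measurable.mul ?_ ?_
    · exact (measurable_one.indicator measurableSet_punctured).comp (by fun_prop)
    · refine Measurable.ennreal_ofReal (Measurable.mul ?_ ?_)
      · exact hψ.continuous.measurable.comp (by fun_prop)
      · exact measurable_tent_log (by fun_prop)
  have hG : ∀ P : ℝ × ℝ, ∫⁻ Q, F P Q = ∫⁻ z : ℝ × ℝ,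
      ENNReal.ofReal (ψ z) * (ENNReal.ofReal (1 + z.1 * z.2)⁻¹ *
        diagWeight ((1 + z.1 * z.2) * P.1, P.2)) := by
    intro P
    have hzero : (P.1 = 0 ∨ P.2 = 0) → ∀ Q, F P Q = 0 := by
      intro hP Q
      have : ψ (-Q.2 / P.1, Q.1 / P.2) = 0 := by
        by_contra h
        have h1 := hψ.mem _ h
        rcases hP with hP | hP <;> simp [hP] at h1
      simp [F, this]
    by_cases hP : P.1 = 0 ∨ P.2 = 0
    · simp only [hzero hP, lintegral_zero]
      rw [eq_comm]
      refine (lintegral_congr fun z => ?_).trans lintegral_zero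
      rcases hP with hP | hP <;> simp [diagWeight, hP]
    push Not at hP
    obtain ⟨hA, hD⟩ := hP
    have hFP : Measurable (F P) := hF.comp measurable_prodMk_left
    have hswap : ∫⁻ Q, F P Q = ∫⁻ z : ℝ × ℝ, (F P ∘ Prod.swap) z :=
      ((Measure.measurePreserving_swap (μ := (volume : Measure ℝ))
        (ν := (volume : Measure ℝ))).lintegral_comp hFP).symm
    rw [hswap, lintegral_eq_mul_comp_mul_left_prod (hFP.comp measurable_swap) (neg_ne_zero.2 hA) hD,
      ← lintegral_const_mul' _ _ ENNReal.ofReal_ne_top]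
    refine lintegral_congr fun z => ?_
    have e3 : (-(-P.1 * z.1) / P.1, P.2 * z.2 / P.2) = z := by
      rw [mul_div_cancel_left₀ _ hD, neg_mul, neg_neg, mul_div_cancel_left₀ _ hA]
    by_cases hz : ψ z = 0
    · simp only [F, Function.comp_apply, Prod.fst_swap, Prod.snd_swap, e3, hz, zero_mul,
        ENNReal.ofReal_zero, mul_zero]
    obtain ⟨hx, hy⟩ := hψ.mem z hz
    have hs : 0 < 1 + z.1 * z.2 := by have := mul_pos hx.1 hy.1; linarith
    have e1 : P.1 * P.2 - -P.1 * z.1 * (P.2 * z.2) = (1 + z.1 * z.2) * P.1 * P.2 := by ring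
    have e2 : |(1 + z.1 * z.2) * P.1 * P.2| / P.2 ^ 2 = |(1 + z.1 * z.2) * P.1| / |P.2| := by
      rw [abs_mul, ← sq_abs P.2, sq, mul_div_mul_right _ _ (abs_ne_zero.2 hD)]
    have e4 : |-P.1| * |P.2| = (1 + z.1 * z.2)⁻¹ * (|(1 + z.1 * z.2) * P.1| * |P.2|) := by
      rw [abs_mul, abs_of_pos hs, abs_neg]
      field_simp
    simp only [F, Function.comp_apply, Prod.fst_swap, Prod.snd_swap, e1, e2, e3]
    rw [diagWeight, e4, ENNReal.ofReal_mul (inv_nonneg.2 hs.le), ENNReal.ofReal_mul (hψ.nonneg z)]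
    ring
  calc ∫⁻ g, ENNReal.ofReal (testFun hψ g) ∂haarPGL
      = ∫⁻ p in detCone, ENNReal.ofReal (testFun hψ (ofMat (colMat p))) := by
        rw [haarPGL, lintegral_map _ measurable_ofMat_colMat]
        exact ((map_continuous (testFun hψ)).measurable).ennreal_ofReal
    _ = ∫⁻ p : (Fin 2 → ℝ) × (Fin 2 → ℝ), F (p.1 0, p.2 1) (p.1 1, p.2 0) := by
        rw [← lintegral_indicator measurableSet_detCone]
        refine lintegral_congr fun p => ?_
        by_cases hp : p ∈ detCone
        · have hp' : p.1 0 * p.2 1 - p.2 0 * p.1 1 ∈ {s : ℝ | s ≠ 0 ∧ |s| ≤ 1} := by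
            rw [← det_colMat]; exact hp
          rw [Set.indicator_of_mem hp, testFun_ofMat hψ hp.1, testMat, det_colMat]
          simp only [F]
          rw [Set.indicator_of_mem hp', Pi.one_apply, one_mul]
          simp [colMat]
        · have hp' : p.1 0 * p.2 1 - p.2 0 * p.1 1 ∉ {s : ℝ | s ≠ 0 ∧ |s| ≤ 1} := by
            rw [← det_colMat]; exact hp
          rw [Set.indicator_of_notMem hp]
          simp only [F]
          rw [Set.indicator_of_notMem hp', zero_mul]
    _ = ∫⁻ P, ∫⁻ Q, F P Q := lintegral_columns F hF
    _ = ∫⁻ P : ℝ × ℝ, ∫⁻ z : ℝ × ℝ, ENNReal.ofReal (ψ z) * (ENNReal.ofReal (1 + z.1 * z.2)⁻¹ *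
          diagWeight ((1 + z.1 * z.2) * P.1, P.2)) := lintegral_congr hG
    _ = ∫⁻ z : ℝ × ℝ, ∫⁻ P : ℝ × ℝ, ENNReal.ofReal (ψ z) * (ENNReal.ofReal (1 + z.1 * z.2)⁻¹ *
          diagWeight ((1 + z.1 * z.2) * P.1, P.2)) := by
        refine lintegral_lintegral_swap (Measurable.aemeasurable ?_)
        refine Measurable.mul ?_ (Measurable.mul ?_ ?_)
        · exact (hψ.continuous.measurable.comp measurable_snd).ennreal_ofReal
        · exact Measurable.ennreal_ofReal (by fun_prop)
        · exact measurable_diagWeight.comp (by fun_prop)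
    _ = ∫⁻ z : ℝ × ℝ, (∫⁻ P, diagWeight P) * ENNReal.ofReal (ψ z / (1 + z.1 * z.2) ^ 2) := by
        refine lintegral_congr fun z => ?_
        by_cases hz : ψ z = 0
        · simp [hz]
        obtain ⟨hx, hy⟩ := hψ.mem z hz
        have hs : 0 < 1 + z.1 * z.2 := by have := mul_pos hx.1 hy.1; linarith
        rw [lintegral_const_mul' _ _ ENNReal.ofReal_ne_top,
          lintegral_const_mul' _ _ ENNReal.ofReal_ne_top,
          lintegral_comp_mul_left_fst measurable_diagWeight hs.ne', abs_of_pos (inv_pos.2 hs),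
          div_eq_mul_inv, ENNReal.ofReal_mul (hψ.nonneg z), ← inv_pow, sq,
          ENNReal.ofReal_mul (inv_nonneg.2 hs.le)]
        ring
    _ = _ := by
        rw [lintegral_const_mul]
        refine Measurable.ennreal_ofReal ?_
        exact hψ.continuous.measurable.div (by fun_prop)

/-- The integral of a weight against `dx dy / (1 + x y)²`, the invariant density of the natural
extension of the Gauss map. -/
def weightIntegral (ψ : ℝ × ℝ → ℝ) : ℝ := ∫ z : ℝ × ℝ, ψ z / (1 + z.1 * z.2) ^ 2

theorem weightIntegral_eq_toReal {ψ : ℝ × ℝ → ℝ} (hψ : IsWeight ψ) :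
    weightIntegral ψ = (∫⁻ z : ℝ × ℝ, ENNReal.ofReal (ψ z / (1 + z.1 * z.2) ^ 2)).toReal := by
  refine integral_eq_lintegral_of_nonneg_ae (Eventually.of_forall fun z => ?_) ?_
  · exact div_nonneg (hψ.nonneg z) (sq_nonneg _)
  · exact (hψ.continuous.measurable.div (by fun_prop)).aestronglyMeasurable

theorem integral_testFun {ψ : ℝ × ℝ → ℝ} (hψ : IsWeight ψ) :
    ∫ g, testFun hψ g ∂haarPGL = (∫⁻ P, diagWeight P).toReal * weightIntegral ψ := by
  rw [integral_eq_lintegral_of_nonneg_ae (Eventually.of_forall (testFun_nonneg hψ))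
    (map_continuous (testFun hψ)).aestronglyMeasurable, lintegral_testFun, ENNReal.toReal_mul,
    weightIntegral_eq_toReal hψ]

/-- An explicit weight, positive on the open unit square. -/
def stdWeight (z : ℝ × ℝ) : ℝ := max (min z.1 (1 - z.1)) 0 * max (min z.2 (1 - z.2)) 0

theorem isWeight_stdWeight : IsWeight stdWeight where
  continuous := by unfold stdWeight; fun_prop
  nonneg z := mul_nonneg (le_max_right _ _) (le_max_right _ _)
  mem z hz := by
    have h : ∀ s : ℝ, max (min s (1 - s)) 0 ≠ 0 → s ∈ Set.Ioo (0 : ℝ) 1 := by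
      intro s hs
      by_contra h
      refine hs (max_eq_right ?_)
      by_contra h2
      push Not at h2
      have := lt_min_iff.1 h2
      exact h ⟨this.1, by linarith [this.2]⟩
    exact ⟨h _ (left_ne_zero_of_mul hz), h _ (right_ne_zero_of_mul hz)⟩

theorem integral_testFun_stdWeight_pos : 0 < ∫ g, testFun isWeight_stdWeight g ∂haarPGL := by
  refine Continuous.integral_pos_of_hasCompactSupport_nonneg_nonzero
    (map_continuous (testFun isWeight_stdWeight)) (testFun isWeight_stdWeight).hasCompactSupport
    (fun g => testFun_nonneg isWeight_stdWeight g) (x := ofMat !![2, -1; 1, 2]) ?_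
  have hdet : (!![2, -1; 1, 2] : Matrix (Fin 2) (Fin 2) ℝ).det = 5 := by
    rw [Matrix.det_fin_two_of]; norm_num
  rw [testFun_ofMat _ (by rw [hdet]; norm_num), testMat, hdet]
  have h1 : |(1 / 2 : ℝ) * Real.log (5 / 4)| < 1 := by
    have h0 : 0 ≤ Real.log (5 / 4) := Real.log_nonneg (by norm_num)
    have h2 := Real.log_le_sub_one_of_pos (show (0 : ℝ) < 5 / 4 by norm_num)
    rw [abs_of_nonneg (by positivity)]
    linarith
  have h3 : 0 < tent ((1 / 2 : ℝ) * Real.log (5 / 4)) := lt_max_of_lt_left (by linarith)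
  have h4 : (0 : ℝ) < stdWeight (1 / 2, 1 / 2) := by norm_num [stdWeight]
  have h5 := (mul_pos h4 h3).ne'
  simp only [Matrix.of_apply, Matrix.cons_val', Matrix.cons_val_zero, Matrix.cons_val_one,
    Matrix.cons_val_fin_one, neg_neg]
  norm_num at h5 ⊢
  exact h5

/-- The integral over `X` of the automorphic sum of a test function is a fixed multiple of the
integral of the weight. -/
theorem exists_integral_autBCF_testFun (m : Measure X) [IsProbabilityMeasure m]
    [SMulInvariantMeasure PGL(2, ℝ) X m] :
    ∃ c : ℝ, 0 < c ∧ ∀ (ψ : ℝ × ℝ → ℝ) (hψ : IsWeight ψ),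
      ∫ x, autBCF (testFun hψ) x ∂m = c * weightIntegral ψ := by
  obtain ⟨c, hc, h⟩ := exists_integral_autBCF_eq m haarPGL
  have hK : 0 < (∫⁻ P, diagWeight P).toReal := by
    have h1 := integral_testFun_stdWeight_pos
    rw [integral_testFun] at h1
    refine lt_of_le_of_ne ENNReal.toReal_nonneg fun h2 => ?_
    rw [← h2, zero_mul] at h1
    exact lt_irrefl _ h1
  refine ⟨c * (∫⁻ P, diagWeight P).toReal, mul_pos hc hK, fun ψ hψ => ?_⟩
  rw [h, integral_testFun, mul_assoc]

theorem weightIntegral_stdWeight_pos : 0 < weightIntegral stdWeight := by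
  have h1 := integral_testFun_stdWeight_pos
  rw [integral_testFun] at h1
  exact pos_of_mul_pos_right h1 ENNReal.toReal_nonneg

/-! ### Automorphic sums along the orbit as sums over convergents -/

/-- A representative of `a t * u α`. -/
def flowMat (t α : ℝ) : Matrix (Fin 2) (Fin 2) ℝ :=
  !![Real.exp t, -(α * Real.exp t); 0, Real.exp (-t)]

theorem det_flowMat (t α : ℝ) : (flowMat t α).det = 1 := by
  rw [flowMat, Matrix.det_fin_two_of, ← Real.exp_add]
  simp

theorem ofMat_flowMat (t α : ℝ) : ofMat (flowMat t α) = a t * u α := by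
  have h1 : (!![Real.exp t, 0; 0, Real.exp (-t)] : Matrix (Fin 2) (Fin 2) ℝ).det ≠ 0 := by
    simp [Matrix.det_fin_two]
  have h2 : (!![1, -α; 0, 1] : Matrix (Fin 2) (Fin 2) ℝ).det ≠ 0 := by
    simp [Matrix.det_fin_two]
  have e1 : a t = ofMat !![Real.exp t, 0; 0, Real.exp (-t)] := by rw [ofMat, dif_pos h1]; rfl
  have e2 : u α = ofMat !![1, -α; 0, 1] := by rw [ofMat, dif_pos h2]; rfl
  rw [e1, e2, ← ofMat_mul h1 h2, flowMat]
  congr 1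
  ext i j
  fin_cases i <;> fin_cases j <;> simp [Matrix.mul_apply, Fin.sum_univ_two, mul_comm]

theorem orbit_eq_toX (t α : ℝ) : a t • u α • x₀ = toX (ofMat (flowMat t α)) := by
  rw [smul_x₀, smul_toX, ofMat_flowMat]

/-- The pair of points `(-(b - α d) / (a - α c), c / d)` attached to an integral matrix. -/
def matPair (α : ℝ) (M : Matrix (Fin 2) (Fin 2) ℤ) : ℝ × ℝ :=
  (-(M 0 1 - α * M 1 1) / (M 0 0 - α * M 1 0), M 1 0 / M 1 1)

/-- At time `t` the element of `Λ` given by `(a, b; c, d)` contributes the weight of its pair of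
points, times the tent function centered at `log |d|`. -/
theorem testFun_flowMat_mul {ψ : ℝ × ℝ → ℝ} (hψ : IsWeight ψ) (t α : ℝ)
    {M : Matrix (Fin 2) (Fin 2) ℤ} (hM : IsUnit M.det) :
    testFun hψ (ofMat (flowMat t α) * ofMat (realMat M))
      = ψ (matPair α M) * tent (t - Real.log |(M 1 1 : ℝ)|) := by
  have h1 : (flowMat t α).det ≠ 0 := by rw [det_flowMat]; exact one_ne_zero
  have h2 := det_realMat_ne_zero hM
  have hdet : |(flowMat t α * realMat M).det| = 1 := by
    rw [Matrix.det_mul, det_flowMat, one_mul, abs_det_realMat hM]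
  have e00 : (flowMat t α * realMat M) 0 0 = Real.exp t * (M 0 0 - α * M 1 0) := by
    simp [flowMat, Matrix.mul_apply, Fin.sum_univ_two]; ring
  have e01 : (flowMat t α * realMat M) 0 1 = Real.exp t * (M 0 1 - α * M 1 1) := by
    simp [flowMat, Matrix.mul_apply, Fin.sum_univ_two]; ring
  have e10 : (flowMat t α * realMat M) 1 0 = Real.exp (-t) * M 1 0 := by
    simp [flowMat, Matrix.mul_apply, Fin.sum_univ_two]
  have e11 : (flowMat t α * realMat M) 1 1 = Real.exp (-t) * M 1 1 := by
    simp [flowMat, Matrix.mul_apply, Fin.sum_univ_two]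
  rw [← ofMat_mul h1 h2, testFun_ofMat hψ (by rw [Matrix.det_mul]; exact mul_ne_zero h1 h2),
    testMat, hdet, e00, e01, e10, e11, ← mul_neg, mul_div_mul_left _ _ (Real.exp_pos t).ne',
    mul_div_mul_left _ _ (Real.exp_pos (-t)).ne']
  by_cases hd : (M 1 1 : ℝ) = 0
  · have h0 : ψ (matPair α M) = 0 := by
      by_contra h
      have := (hψ.mem _ h).2
      simp [matPair, hd] at this
    have h0' := h0
    rw [matPair] at h0'
    rw [h0, h0', zero_mul, zero_mul]
  · congr 2
    rw [Real.log_div one_ne_zero (by positivity), Real.log_one, Real.log_pow,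
      Real.log_mul (Real.exp_pos _).ne' hd, Real.log_exp, Real.log_abs]
    push_cast
    ring

/-- An element of `Λ` whose pair of points lies in the open unit square is the class of an integral
matrix with bottom row `0 < c < d` that maps a point of `(0, 1)` to `α`. -/
theorem exists_reduced {α : ℝ} {M : Matrix (Fin 2) (Fin 2) ℤ} (hM : IsUnit M.det)
    (hx : (matPair α M).1 ∈ Set.Ioo (0 : ℝ) 1) (hy : (matPair α M).2 ∈ Set.Ioo (0 : ℝ) 1) :
    ∃ N : Matrix (Fin 2) (Fin 2) ℤ, ofMat (realMat N) = ofMat (realMat M) ∧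
      |N 1 1| = |M 1 1| ∧ 0 < N 1 0 ∧ N 1 0 < N 1 1 ∧ IsUnit (N 0 0 * N 1 1 - N 0 1 * N 1 0) ∧
      α * (N 1 0 * (matPair α M).1 + N 1 1) = N 0 0 * (matPair α M).1 + N 0 1 := by
  have hA : (M 0 0 - α * M 1 0 : ℝ) ≠ 0 := fun h => by simp [matPair, h] at hx
  have hD : (M 1 1 : ℝ) ≠ 0 := fun h => by simp [matPair, h] at hy
  have hmob : α * (M 1 0 * (matPair α M).1 + M 1 1) = M 0 0 * (matPair α M).1 + M 0 1 := by
    have : (matPair α M).1 * (M 0 0 - α * M 1 0) = -(M 0 1 - α * M 1 1) := div_mul_cancel₀ _ hA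
    linear_combination -this
  have hc : (M 1 0 : ℝ) = (matPair α M).2 * M 1 1 := (div_mul_cancel₀ _ hD).symm
  rcases lt_or_gt_of_ne hD with hd | hd
  · refine ⟨-M, ?_, by simp, ?_, ?_, ?_, ?_⟩
    · have e : realMat (-M) = (-1 : ℝ) • realMat M := by
        ext i j
        simp
      rw [e, ofMat_smul (by norm_num)]
    · have : (M 1 0 : ℝ) < 0 := by rw [hc]; exact mul_neg_of_pos_of_neg hy.1 hd
      simpa using this
    · have : (M 1 1 : ℝ) < M 1 0 := by rw [hc]; nlinarith [hy.2]
      simpa using this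
    · simpa [Matrix.det_fin_two] using hM
    · simp only [Matrix.neg_apply]
      push_cast
      linear_combination -hmob
  · refine ⟨M, rfl, rfl, ?_, ?_, ?_, hmob⟩
    · have : (0 : ℝ) < M 1 0 := by rw [hc]; exact mul_pos hy.1 hd
      exact_mod_cast this
    · have : (M 1 0 : ℝ) < M 1 1 := by rw [hc]; nlinarith [hy.2]
      exact_mod_cast this
    · rwa [Matrix.det_fin_two] at hM

/-- The orbit of a rational point leaves every compact set, hence is not equidistributed. -/
theorem irrational_of_pathEquidistributed {α : ℝ}
    (m : Measure X) [IsProbabilityMeasure m] [SMulInvariantMeasure PGL(2, ℝ) X m]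
    (h : PathEquidistributed (fun t => a t • u α • x₀) m) : Irrational α := by
  by_contra hα
  obtain ⟨Q, hQ, hb⟩ := exists_bound_of_not_irrational hα
  obtain ⟨c, hc, hint⟩ := exists_integral_autBCF_testFun m
  have hlim := h (autBCF (testFun isWeight_stdWeight))
  rw [hint] at hlim
  set T₀ : ℝ := 1 + Real.log Q with hT₀
  have hT0 : 0 ≤ T₀ := by
    have : 0 ≤ Real.log Q := Real.log_nonneg (by exact_mod_cast hQ)
    linarith
  have hzero : ∀ t, T₀ < t → autBCF (testFun isWeight_stdWeight) (a t • u α • x₀) = 0 := by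
    intro t ht
    rw [orbit_eq_toX, autBCF_toX]
    refine (finsum_congr fun γ => ?_).trans finsum_zero
    obtain ⟨M, hM, hγ⟩ := (mem_Lam_iff γ).1 γ.2
    rw [← hγ, testFun_flowMat_mul _ _ _ hM]
    by_contra hne
    obtain ⟨hx, hy⟩ := isWeight_stdWeight.mem _ (left_ne_zero_of_mul hne)
    obtain ⟨N, -, hNM, h0, h1, h2, h3⟩ := exists_reduced hM hx hy
    have hle := hb _ _ _ _ _ hx h0 h1 h2 h3
    have htent := abs_lt_one_of_tent_ne_zero (right_ne_zero_of_mul hne)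
    have hd : |(M 1 1 : ℝ)| ≤ Q := by
      rw [← Int.cast_abs, ← hNM, abs_of_pos (h0.trans h1)]
      exact_mod_cast hle
    have hd0 : 0 < |(M 1 1 : ℝ)| := by
      rw [← Int.cast_abs, ← hNM, abs_of_pos (h0.trans h1)]
      exact_mod_cast h0.trans h1
    have := Real.log_le_log hd0 hd
    have := (abs_lt.1 htent).2
    linarith
  have hconst : ∀ T, T₀ ≤ T →
      ∫ t in (0 : ℝ)..T, autBCF (testFun isWeight_stdWeight) (a t • u α • x₀)
        = ∫ t in (0 : ℝ)..T₀, autBCF (testFun isWeight_stdWeight) (a t • u α • x₀) := by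
    intro T hT
    rw [intervalIntegral.integral_of_le hT0, intervalIntegral.integral_of_le (hT0.trans hT)]
    refine setIntegral_eq_of_subset_of_forall_sdiff_eq_zero measurableSet_Ioc
      (Set.Ioc_subset_Ioc_right hT) ?_
    rintro t ⟨ht1, ht2⟩
    exact hzero t (by
      by_contra h
      exact ht2 ⟨ht1.1, not_lt.1 h⟩)
  have hlim0 : Tendsto (fun T : ℝ => T⁻¹ *
      ∫ t in (0 : ℝ)..T, autBCF (testFun isWeight_stdWeight) (a t • u α • x₀)) atTop (𝓝 0) := by
    have := (tendsto_inv_atTop_zero (𝕜 := ℝ)).mul_const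
      (∫ t in (0 : ℝ)..T₀, autBCF (testFun isWeight_stdWeight) (a t • u α • x₀))
    rw [zero_mul] at this
    refine this.congr' ?_
    filter_upwards [eventually_ge_atTop T₀] with T hT
    rw [hconst T hT]
  have := tendsto_nhds_unique hlim hlim0
  exact (mul_pos hc weightIntegral_stdWeight_pos).ne' this

theorem isUnit_det_cfMat (α : ℝ) (n : ℕ) : IsUnit (cfMat α n).det := by
  rw [det_cfMat]
  exact (isUnit_one.neg).pow n

/-- The point `(x_n, y_n)` of the natural extension: the `n`-th point of the Gauss orbit and the
ratio `q_{n-1} / q_n`. -/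
def cfPair (α : ℝ) (n : ℕ) : ℝ × ℝ := (gaussMap^[n] α, cfMat α n 1 0 / cfDen α n)

/-- The logarithm of the denominator `q_n`, the time at which the orbit meets the `n`-th convergent. -/
def logDen (α : ℝ) (n : ℕ) : ℝ := Real.log (cfDen α n)

theorem matPair_cfMat {α : ℝ} (hα : Irrational α) (n : ℕ) : matPair α (cfMat α n) = cfPair α n := by
  have hm := cfMat_moebius hα n
  have hA : (cfMat α n 0 0 - α * cfMat α n 1 0 : ℝ) ≠ 0 := by
    intro h0
    have h1 : (cfMat α n 0 1 - α * cfMat α n 1 1 : ℝ) = 0 := by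
      linear_combination gaussMap^[n] α * (-h0) - hm
    have hdet : ((cfMat α n).det : ℝ) = 0 := by
      rw [Matrix.det_fin_two]
      push_cast
      linear_combination (cfMat α n 1 1 : ℝ) * h0 - (cfMat α n 1 0 : ℝ) * h1
    exact (isUnit_det_cfMat α n).ne_zero (by exact_mod_cast hdet)
  rw [matPair, cfPair, cfDen]
  congr 1
  rw [div_eq_iff hA]
  linear_combination hm

theorem ofMat_cfMat_mem (α : ℝ) (n : ℕ) : ofMat (realMat (cfMat α n)) ∈ Lam :=
  (mem_Lam_iff _).2 ⟨_, isUnit_det_cfMat α n, rfl⟩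

section Irrational

variable {α : ℝ} (hα : Irrational α) (h : α ∈ Set.Ioo (0 : ℝ) 1)

include hα h

theorem cfDen_pos (n : ℕ) : (0 : ℝ) < cfDen α n := by
  exact_mod_cast zero_lt_one.trans_le (one_le_cfDen hα h n)

/-- The matrices of convergents of positive index have distinct classes. They are told apart
by their denominators, which strictly increase from the index `1` on. -/
theorem eq_of_ofMat_cfMat_eq {n k : ℕ} (hn : 0 < n) (hk : 0 < k)
    (e : ofMat (realMat (cfMat α n)) = ofMat (realMat (cfMat α k))) : n = k := by
  have hun := isUnit_det_cfMat α n
  have huk := isUnit_det_cfMat α k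
  obtain ⟨c, hc, ec⟩ := (ofMat_eq_ofMat_iff (det_realMat_ne_zero hun)
    (det_realMat_ne_zero huk)).1 e
  have habs : |c| = 1 := by
    have h1 := congrArg (fun N : Matrix (Fin 2) (Fin 2) ℝ => |N.det|) ec
    simp only [Matrix.det_smul, abs_mul, abs_det_realMat hun, abs_det_realMat huk,
      Fintype.card_fin, mul_one, abs_pow] at h1
    exact (pow_eq_one_iff_of_nonneg (abs_nonneg c) two_ne_zero).1 h1.symm
  have hden : (cfDen α k : ℝ) = c * cfDen α n := by
    have h1 := congrFun (congrFun ec 1) 1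
    simpa [cfDen] using h1
  have hc0 : 0 < c := by
    have h1 := cfDen_pos hα h k
    rw [hden] at h1
    exact pos_of_mul_pos_left h1 (cfDen_pos hα h n).le
  rw [abs_of_pos hc0] at habs
  rw [habs, one_mul] at hden
  have hden' : cfDen α k = cfDen α n := by exact_mod_cast hden
  have hmono : StrictMono fun i => cfDen α (i + 1) :=
    strictMono_nat_of_lt_succ fun i => cfDen_lt_succ hα h i
  obtain ⟨n, rfl⟩ := Nat.exists_eq_succ_of_ne_zero hn.ne'
  obtain ⟨k, rfl⟩ := Nat.exists_eq_succ_of_ne_zero hk.ne'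
  have := hmono.injective hden'
  omega

/-- Along the orbit of `α`, the automorphic sum is a sum over the convergents of `α`. The index `0`
does not contribute, since `y_0 = 0`, and the matrices of positive index have distinct classes. -/
theorem autBCF_orbit_eq_finsum {ψ : ℝ × ℝ → ℝ} (hψ : IsWeight ψ) (t : ℝ) :
    autBCF (testFun hψ) (a t • u α • x₀) = ∑ᶠ n, ψ (cfPair α n) * tent (t - logDen α n) := by
  let f : Lam → ℝ := fun γ => testFun hψ (ofMat (flowMat t α) * γ)
  let g : ℕ → Lam := fun n => ⟨ofMat (realMat (cfMat α n)), ofMat_cfMat_mem α n⟩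
  have hfg : ∀ n, f (g n) = ψ (cfPair α n) * tent (t - logDen α n) := by
    intro n
    simp only [f, g]
    rw [testFun_flowMat_mul hψ t α (isUnit_det_cfMat α n), matPair_cfMat hα, logDen,
      ← cfDen, abs_of_pos (cfDen_pos hα h n)]
  have hsupp : Function.support f ⊆ Set.range g := by
    intro γ hγ
    obtain ⟨M, hM, e⟩ := (mem_Lam_iff γ).1 γ.2
    have hγ' : f γ ≠ 0 := hγ
    simp only [f] at hγ'
    rw [← e, testFun_flowMat_mul hψ t α hM] at hγ'
    obtain ⟨hx, hy⟩ := hψ.mem _ (left_ne_zero_of_mul hγ')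
    obtain ⟨N, hNM, -, h0, h1, h2, h3⟩ := exists_reduced hM hx hy
    obtain ⟨n, hn, -⟩ := exists_cfMat_eq h (N 1 1).toNat _ _ _ _ _ (Int.self_le_toNat _) hx h0 h1
      h2 h3
    refine ⟨n, Subtype.ext ?_⟩
    simp only [g]
    rw [← e, ← hNM, hn, ← Matrix.eta_fin_two N]
  have hpos : ∀ n ∈ Function.support (f ∘ g), 0 < n := by
    intro n hn
    have hn' : f (g n) ≠ 0 := hn
    rw [hfg] at hn'
    have hy := (hψ.mem _ (left_ne_zero_of_mul hn')).2
    refine Nat.pos_of_ne_zero fun h0 => ?_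
    subst h0
    simp [cfPair, cfMat] at hy
  have hinj : (Function.support (f ∘ g)).InjOn g := fun n hn k hk e =>
    eq_of_ofMat_cfMat_eq hα h (hpos n hn) (hpos k hk) (congrArg Subtype.val e)
  rw [orbit_eq_toX, autBCF_toX]
  calc ∑ᶠ γ, f γ = ∑ᶠ γ ∈ Set.range g, f γ := by
        rw [← finsum_mem_univ]
        refine finsum_mem_inter_support_eq f _ _ ?_
        rw [Set.univ_inter, Set.inter_eq_right.2 hsupp]
    _ = ∑ᶠ n, f (g n) := finsum_mem_range' hinj
    _ = _ := finsum_congr hfg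

theorem logDen_monotone : Monotone (logDen α) := fun _ _ hnk =>
  Real.log_le_log (cfDen_pos hα h _) (by exact_mod_cast cfDen_monotone hα h hnk)

theorem logDen_add_two (n : ℕ) : logDen α n + 1 / 2 ≤ logDen α (n + 2) := by
  have h1 : Real.log (2 * cfDen α n) ≤ logDen α (n + 2) :=
    Real.log_le_log (mul_pos two_pos (cfDen_pos hα h n))
      (by exact_mod_cast two_mul_cfDen_le hα h n)
  rw [Real.log_mul two_ne_zero (cfDen_pos hα h n).ne'] at h1
  have := Real.log_two_gt_d9
  rw [logDen]
  linarith

theorem logDen_add_four (n : ℕ) : logDen α n + 1 ≤ logDen α (n + 4) := by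
  linarith [logDen_add_two hα h n, logDen_add_two hα h (n + 2)]

theorem logDen_nonneg (n : ℕ) : 0 ≤ logDen α n :=
  Real.log_nonneg (by exact_mod_cast one_le_cfDen hα h n)

theorem tendsto_logDen : Tendsto (logDen α) atTop atTop := by
  refine tendsto_atTop_atTop_of_monotone (logDen_monotone hα h) fun B => ?_
  obtain ⟨k, hk⟩ := exists_nat_ge B
  have : ∀ k : ℕ, (k : ℝ) ≤ logDen α (4 * k) := by
    intro k
    induction k with
    | zero => simpa using logDen_nonneg hα h 0
    | succ k ih =>
      have := logDen_add_four hα h (4 * k)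
      rw [mul_add, mul_one]
      push_cast
      linarith
  exact ⟨4 * k, hk.trans (this k)⟩

theorem autBCF_orbit_eq_sum {ψ : ℝ × ℝ → ℝ} (hψ : IsWeight ψ) {t : ℝ} {N : ℕ}
    (ht : t + 1 ≤ logDen α N) :
    autBCF (testFun hψ) (a t • u α • x₀)
      = ∑ n ∈ Finset.range N, ψ (cfPair α n) * tent (t - logDen α n) := by
  rw [autBCF_orbit_eq_finsum hα h hψ]
  refine finsum_eq_sum_of_support_subset _ fun n hn => ?_
  rw [Finset.coe_range, Set.mem_Iio]
  by_contra hN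
  have h1 := (abs_lt.1 (abs_lt_one_of_tent_ne_zero (right_ne_zero_of_mul hn))).1
  have h2 := logDen_monotone hα h (not_lt.1 hN)
  linarith

end Irrational

theorem integral_tent_eq_one {p q : ℝ} (hp : p ≤ -1) (hq : 1 ≤ q) : ∫ s in p..q, tent s = 1 := by
  have hint : ∀ p q, IntervalIntegrable tent volume p q := fun p q =>
    continuous_tent.intervalIntegrable p q
  have hz : ∀ s, 1 ≤ |s| → tent s = 0 := fun s hs => max_eq_right (by linarith)
  have e1 : ∫ s in p..(-1), tent s = 0 := by
    rw [intervalIntegral.integral_congr (g := fun _ => (0 : ℝ)), intervalIntegral.integral_zero]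
    intro s hs
    rw [Set.uIcc_of_le hp] at hs
    exact hz s (by rw [abs_of_nonpos (by linarith [hs.2])]; linarith [hs.2])
  have e2 : ∫ s in (1 : ℝ)..q, tent s = 0 := by
    rw [intervalIntegral.integral_congr (g := fun _ => (0 : ℝ)), intervalIntegral.integral_zero]
    intro s hs
    rw [Set.uIcc_of_le hq] at hs
    exact hz s (by rw [abs_of_nonneg (by linarith [hs.1])]; linarith [hs.1])
  have e3 : ∫ s in (-1 : ℝ)..0, tent s = 1 / 2 := by
    rw [intervalIntegral.integral_congr (g := fun s => 1 + s)]
    · rw [intervalIntegral.integral_add (by simp) (by simp), integral_id]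
      norm_num
    intro s hs
    rw [Set.uIcc_of_le (by norm_num)] at hs
    simp only [tent]
    rw [abs_of_nonpos hs.2, max_eq_left] <;> linarith [hs.1]
  have e4 : ∫ s in (0 : ℝ)..1, tent s = 1 / 2 := by
    rw [intervalIntegral.integral_congr (g := fun s => 1 - s)]
    · rw [intervalIntegral.integral_sub (by simp) (by simp), integral_id]
      norm_num
    intro s hs
    rw [Set.uIcc_of_le (by norm_num)] at hs
    simp only [tent]
    rw [abs_of_nonneg hs.1, max_eq_left] ; linarith [hs.2]
  rw [← intervalIntegral.integral_add_adjacent_intervals (hint p (-1)) (hint (-1) q),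
    ← intervalIntegral.integral_add_adjacent_intervals (hint (-1) 0) (hint 0 q),
    ← intervalIntegral.integral_add_adjacent_intervals (hint 0 1) (hint 1 q), e1, e2, e3, e4]
  norm_num

/-- The time that the tent function centered at `l` spends in `[0, T]`. -/
def tentTime (T l : ℝ) : ℝ := ∫ t in (0 : ℝ)..T, tent (t - l)

theorem tentTime_eq (T l : ℝ) : tentTime T l = ∫ s in (-l)..(T - l), tent s := by
  rw [tentTime, intervalIntegral.integral_comp_sub_right, zero_sub]

theorem tentTime_nonneg {T : ℝ} (hT : 0 ≤ T) (l : ℝ) : 0 ≤ tentTime T l :=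
  intervalIntegral.integral_nonneg hT fun _ _ => tent_nonneg _

theorem tentTime_le_one {T : ℝ} (hT : 0 ≤ T) (l : ℝ) : tentTime T l ≤ 1 := by
  rw [tentTime_eq, ← integral_tent_eq_one (p := min (-l) (-1)) (q := max (T - l) 1)
    (min_le_right _ _) (le_max_right _ _)]
  refine intervalIntegral.integral_mono_interval (min_le_left _ _) (by linarith) (le_max_left _ _)
    (Eventually.of_forall tent_nonneg) (continuous_tent.intervalIntegrable _ _)

theorem tentTime_eq_one {T l : ℝ} (h1 : 1 ≤ l) (h2 : l + 1 ≤ T) : tentTime T l = 1 := by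
  rw [tentTime_eq, integral_tent_eq_one] <;> linarith

theorem IsWeight.exists_bound {ψ : ℝ × ℝ → ℝ} (hψ : IsWeight ψ) : ∃ B, 0 ≤ B ∧ ∀ z, ψ z ≤ B := by
  obtain ⟨B, hB⟩ := (isCompact_Icc (a := (0 : ℝ)) (b := 1)).prod
    (isCompact_Icc (a := (0 : ℝ)) (b := 1)) |>.exists_bound_of_continuousOn hψ.continuous.continuousOn
  refine ⟨max B 0, le_max_right _ _, fun z => ?_⟩
  by_cases hz : ψ z = 0
  · rw [hz]; exact le_max_right _ _
  · obtain ⟨hx, hy⟩ := hψ.mem z hz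
    exact ((le_abs_self _).trans (hB z ⟨Set.Ioo_subset_Icc_self hx, Set.Ioo_subset_Icc_self hy⟩)).trans
      (le_max_left _ _)

section Irrational

variable {α : ℝ} (hα : Irrational α) (h : α ∈ Set.Ioo (0 : ℝ) 1)

include hα h

theorem integral_orbit_eq_sum {ψ : ℝ × ℝ → ℝ} (hψ : IsWeight ψ) {T : ℝ} (hT : 0 ≤ T) {N : ℕ}
    (hN : T + 1 ≤ logDen α N) :
    ∫ t in (0 : ℝ)..T, autBCF (testFun hψ) (a t • u α • x₀)
      = ∑ n ∈ Finset.range N, ψ (cfPair α n) * tentTime T (logDen α n) := by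
  have e : ∫ t in (0 : ℝ)..T, autBCF (testFun hψ) (a t • u α • x₀)
      = ∫ t in (0 : ℝ)..T, ∑ n ∈ Finset.range N, ψ (cfPair α n) * tent (t - logDen α n) := by
    refine intervalIntegral.integral_congr fun t ht => ?_
    rw [Set.uIcc_of_le hT] at ht
    exact autBCF_orbit_eq_sum hα h hψ (by linarith [ht.2])
  rw [e, intervalIntegral.integral_finsetSum]
  · refine Finset.sum_congr rfl fun n _ => ?_
    rw [intervalIntegral.integral_const_mul, tentTime]
  · intro n _
    exact (continuous_const.mul (continuous_tent.comp (continuous_sub_right _))).intervalIntegrable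
      _ _

/-- Up to a bounded error, the integral over the orbit until time `log q_N` counts the first `N`
points of the natural extension, each with its weight. -/
theorem abs_integral_orbit_sub_sum_le {ψ : ℝ × ℝ → ℝ} (hψ : IsWeight ψ) {B : ℝ} (hB0 : 0 ≤ B)
    (hB : ∀ z, ψ z ≤ B) (N : ℕ) :
    |(∫ t in (0 : ℝ)..logDen α N, autBCF (testFun hψ) (a t • u α • x₀))
      - ∑ n ∈ Finset.range N, ψ (cfPair α n)| ≤ 15 * B := by
  have hT := logDen_nonneg hα h N
  rw [integral_orbit_eq_sum hα h hψ hT (logDen_add_four hα h N)]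
  have e1 : ∑ n ∈ Finset.range (N + 4), ψ (cfPair α n)
      = ∑ n ∈ Finset.range N, ψ (cfPair α n) + ∑ n ∈ Finset.range 4, ψ (cfPair α (N + n)) :=
    Finset.sum_range_add _ _ _
  have e2 : |∑ n ∈ Finset.range 4, ψ (cfPair α (N + n))| ≤ 4 * B := by
    rw [abs_of_nonneg (Finset.sum_nonneg fun n _ => hψ.nonneg _)]
    refine (Finset.sum_le_card_nsmul _ _ B fun n _ => hB _).trans ?_
    simp
  -- the bump at `logDen α n` is cut off by the interval of integration only for `n < 4` and for
  -- `N - 4 < n`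
  have e3 : |∑ n ∈ Finset.range (N + 4),
      (ψ (cfPair α n) * tentTime (logDen α N) (logDen α n) - ψ (cfPair α n))| ≤ 11 * B := by
    refine (Finset.abs_sum_le_sum_abs _ _).trans ?_
    have hterm : ∀ n ∈ Finset.range (N + 4),
        |ψ (cfPair α n) * tentTime (logDen α N) (logDen α n) - ψ (cfPair α n)|
          ≤ if n ∈ Finset.range 4 ∪ Finset.Ico (N - 3) (N + 4) then B else 0 := by
      intro n hn
      have h1 := hψ.nonneg (cfPair α n)
      have h2 := tentTime_nonneg hT (logDen α n)
      have h3 := tentTime_le_one hT (logDen α n)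
      split_ifs with hmem
      · rw [abs_le]
        constructor <;> nlinarith [hB (cfPair α n), mul_nonneg h1 h2]
      · simp only [Finset.mem_union, Finset.mem_range, Finset.mem_Ico] at hmem hn
        obtain ⟨k, rfl⟩ : ∃ k, n = k + 4 := ⟨n - 4, by omega⟩
        rw [tentTime_eq_one, mul_one, sub_self, abs_zero]
        · linarith [logDen_add_four hα h k, logDen_nonneg hα h k]
        · exact (logDen_add_four hα h _).trans (logDen_monotone hα h (by omega))
    refine (Finset.sum_le_sum hterm).trans ?_
    rw [← Finset.sum_filter, Finset.sum_const, nsmul_eq_mul]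
    refine mul_le_mul_of_nonneg_right ?_ hB0
    have hcard : ((Finset.range (N + 4)).filter fun n =>
        n ∈ Finset.range 4 ∪ Finset.Ico (N - 3) (N + 4)).card ≤ 11 := by
      refine (Finset.card_le_card (fun n hn => (Finset.mem_filter.1 hn).2)).trans ?_
      refine (Finset.card_union_le _ _).trans ?_
      simp only [Finset.card_range, Nat.card_Ico]
      omega
    exact_mod_cast hcard
  rw [Finset.sum_sub_distrib] at e3
  rw [e1] at e3
  obtain ⟨h1, h2⟩ := abs_le.1 e2
  obtain ⟨h3, h4⟩ := abs_le.1 e3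
  rw [abs_le]
  constructor <;> linarith

/-- If the orbit is equidistributed then the averages of a weight along the natural extension,
normalized by the logarithm of the denominator, converge to the integral of the weight. -/
theorem exists_tendsto_sum_div_logDen (m : Measure X) [IsProbabilityMeasure m]
    [SMulInvariantMeasure PGL(2, ℝ) X m]
    (heq : PathEquidistributed (fun t => a t • u α • x₀) m) :
    ∃ c : ℝ, 0 < c ∧ ∀ ψ : ℝ × ℝ → ℝ, IsWeight ψ →
      Tendsto (fun N => (∑ n ∈ Finset.range N, ψ (cfPair α n)) / logDen α N) atTop
        (𝓝 (c * weightIntegral ψ)) := by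
  obtain ⟨c, hc, hint⟩ := exists_integral_autBCF_testFun m
  refine ⟨c, hc, fun ψ hψ => ?_⟩
  obtain ⟨B, hB0, hB⟩ := hψ.exists_bound
  have h1 := (heq (autBCF (testFun hψ))).comp (tendsto_logDen hα h)
  rw [hint] at h1
  have h2 : Tendsto (fun N => (logDen α N)⁻¹ * (15 * B)) atTop (𝓝 0) := by
    simpa using ((tendsto_inv_atTop_zero (𝕜 := ℝ)).comp (tendsto_logDen hα h)).mul_const (15 * B)
  have h3 : Tendsto (fun N => (logDen α N)⁻¹ * ((∑ n ∈ Finset.range N, ψ (cfPair α n)) -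
      ∫ t in (0 : ℝ)..logDen α N, autBCF (testFun hψ) (a t • u α • x₀))) atTop (𝓝 0) := by
    refine squeeze_zero_norm (fun N => ?_) h2
    rw [norm_mul, Real.norm_of_nonneg (inv_nonneg.2 (logDen_nonneg hα h N)), norm_sub_rev]
    exact mul_le_mul_of_nonneg_left (abs_integral_orbit_sub_sum_le hα h hψ hB0 hB N)
      (inv_nonneg.2 (logDen_nonneg hα h N))
  have h4 := h3.add h1
  rw [zero_add] at h4
  refine h4.congr fun N => ?_
  simp only [Function.comp_apply]
  rw [div_eq_inv_mul]
  ring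

end Irrational

/-! ### The Gauss measure -/

theorem integral_gaussMeasure (f : ℝ → ℝ) :
    ∫ x : Set.Ioo (0 : ℝ) 1, f x ∂gaussMeasure
      = (Real.log 2)⁻¹ * ∫ x in Set.Ioo (0 : ℝ) 1, f x / (1 + x) := by
  have hlog : 0 < Real.log 2 := Real.log_pos one_lt_two
  rw [gaussMeasure, integral_withDensity_eq_integral_toReal_smul
    (Measurable.ennreal_ofReal (by fun_prop)) (Eventually.of_forall fun _ => ENNReal.ofReal_lt_top),
    ← integral_const_mul, ← integral_subtype_comap measurableSet_Ioo]
  refine integral_congr_ae (Eventually.of_forall fun x => ?_)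
  have hx := x.2.1
  simp only [smul_eq_mul]
  rw [ENNReal.toReal_ofReal (by positivity)]
  ring

theorem integral_Ioo_one_div : ∫ x in Set.Ioo (0 : ℝ) 1, 1 / (1 + x) = Real.log 2 := by
  rw [← integral_Ioc_eq_integral_Ioo, ← intervalIntegral.integral_of_le zero_le_one,
    intervalIntegral.integral_eq_sub_of_hasDerivAt (f := fun x => Real.log (1 + x))]
  · norm_num
  · intro x hx
    rw [Set.uIcc_of_le zero_le_one] at hx
    exact ((hasDerivAt_id x).const_add 1).log (by simp only [id]; linarith [hx.1])
  · refine ContinuousOn.intervalIntegrable fun x hx => ?_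
    rw [Set.uIcc_of_le zero_le_one] at hx
    exact (continuousAt_const.div (by fun_prop) (by linarith [hx.1])).continuousWithinAt

instance : IsProbabilityMeasure gaussMeasure := by
  have h := integral_gaussMeasure fun _ => 1
  rw [integral_Ioo_one_div, inv_mul_cancel₀ (Real.log_pos one_lt_two).ne', integral_const,
    smul_eq_mul, mul_one, measureReal_def] at h
  exact ⟨(ENNReal.toReal_eq_one_iff _).1 h⟩

theorem integral_Ioo_one_div_sq {x : ℝ} (hx : 0 < x) :
    ∫ y in Set.Ioo (0 : ℝ) 1, 1 / (1 + x * y) ^ 2 = 1 / (1 + x) := by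
  have hpos : ∀ y ∈ Set.uIcc (0 : ℝ) 1, 0 < 1 + x * y := fun y hy => by
    rw [Set.uIcc_of_le zero_le_one] at hy
    have := mul_nonneg hx.le hy.1
    linarith
  rw [← integral_Ioc_eq_integral_Ioo, ← intervalIntegral.integral_of_le zero_le_one,
    intervalIntegral.integral_eq_sub_of_hasDerivAt (f := fun y => y / (1 + x * y))]
  · simp
  · intro y hy
    have h1 : HasDerivAt (fun y => 1 + x * y) (x * 1) y := ((hasDerivAt_id y).const_mul x).const_add 1
    refine HasDerivAt.congr_deriv ((hasDerivAt_id' y).div h1 (hpos y hy).ne') ?_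
    ring
  · refine ContinuousOn.intervalIntegrable fun y hy => ?_
    exact (continuousAt_const.div (g := fun y => (1 + x * y) ^ 2) (by fun_prop)
      (pow_ne_zero 2 (hpos y hy).ne')).continuousWithinAt

/-! ### Cutoffs and the absence of escape of mass -/

/-- The extension by zero to the real line of a function on `(0, 1)`. -/
def extendIoo (f : Set.Ioo (0 : ℝ) 1 → ℝ) (x : ℝ) : ℝ :=
  if h : x ∈ Set.Ioo (0 : ℝ) 1 then f ⟨x, h⟩ else 0

theorem extendIoo_coe (f : Set.Ioo (0 : ℝ) 1 → ℝ) (x : Set.Ioo (0 : ℝ) 1) :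
    extendIoo f x = f x := dif_pos x.2

theorem continuousAt_extendIoo {f : Set.Ioo (0 : ℝ) 1 → ℝ} (hf : Continuous f) {x : ℝ}
    (hx : x ∈ Set.Ioo (0 : ℝ) 1) : ContinuousAt (extendIoo f) x := by
  have h : ContinuousOn (extendIoo f) (Set.Ioo 0 1) := by
    rw [continuousOn_iff_continuous_domRestrict]
    exact hf.congr fun y => (extendIoo_coe f y).symm
  exact h.continuousAt (isOpen_Ioo.mem_nhds hx)

theorem measurable_extendIoo {f : Set.Ioo (0 : ℝ) 1 → ℝ} (hf : Continuous f) :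
    Measurable (extendIoo f) :=
  Measurable.dite hf.measurable measurable_const measurableSet_Ioo

theorem extendIoo_nonneg {f : Set.Ioo (0 : ℝ) 1 → ℝ} (hf : ∀ x, 0 ≤ f x) (x : ℝ) :
    0 ≤ extendIoo f x := by
  rw [extendIoo]
  split_ifs with h
  exacts [hf _, le_rfl]

theorem extendIoo_le {f : Set.Ioo (0 : ℝ) 1 → ℝ} {B : ℝ} (hB0 : 0 ≤ B) (hf : ∀ x, f x ≤ B) (x : ℝ) :
    extendIoo f x ≤ B := by
  rw [extendIoo]
  split_ifs with h
  exacts [hf _, hB0]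

/-- A cutoff function, equal to one at the points of the unit square at distance at least `k⁻¹`
from its boundary. -/
def cutoff (k : ℕ) (z : ℝ × ℝ) : ℝ := min 1 ((k : ℝ) ^ 2 * stdWeight z)

theorem isWeight_cutoff (k : ℕ) : IsWeight (cutoff k) where
  continuous := continuous_const.min (continuous_const.mul isWeight_stdWeight.continuous)
  nonneg z := le_min zero_le_one (mul_nonneg (by positivity) (isWeight_stdWeight.nonneg z))
  mem z hz := isWeight_stdWeight.mem z fun h => hz (by simp [cutoff, h])

theorem cutoff_le_one (k : ℕ) (z : ℝ × ℝ) : cutoff k z ≤ 1 := min_le_left _ _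

theorem stdWeight_pos {z : ℝ × ℝ} (hx : z.1 ∈ Set.Ioo (0 : ℝ) 1) (hy : z.2 ∈ Set.Ioo (0 : ℝ) 1) :
    0 < stdWeight z :=
  mul_pos (lt_max_of_lt_left (lt_min hx.1 (by linarith [hx.2])))
    (lt_max_of_lt_left (lt_min hy.1 (by linarith [hy.2])))

theorem cutoff_eq_one {k : ℕ} (hk : 0 < k) {z : ℝ × ℝ} (h1 : (k : ℝ)⁻¹ ≤ z.1)
    (h2 : (k : ℝ)⁻¹ ≤ 1 - z.1) (h3 : (k : ℝ)⁻¹ ≤ z.2) (h4 : (k : ℝ)⁻¹ ≤ 1 - z.2) :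
    cutoff k z = 1 := by
  refine min_eq_left ?_
  have hk0 : (0 : ℝ) < k := by exact_mod_cast hk
  have h5 : (k : ℝ)⁻¹ ≤ max (min z.1 (1 - z.1)) 0 := le_max_of_le_left (le_min h1 h2)
  have h6 : (k : ℝ)⁻¹ ≤ max (min z.2 (1 - z.2)) 0 := le_max_of_le_left (le_min h3 h4)
  have h7 : (k : ℝ)⁻¹ * (k : ℝ)⁻¹ ≤ stdWeight z := mul_le_mul h5 h6 (by positivity)
    (le_max_right _ _)
  calc (1 : ℝ) = (k : ℝ) ^ 2 * ((k : ℝ)⁻¹ * (k : ℝ)⁻¹) := by field_simp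
    _ ≤ _ := mul_le_mul_of_nonneg_left h7 (by positivity)

theorem tendsto_cutoff {z : ℝ × ℝ} (hx : z.1 ∈ Set.Ioo (0 : ℝ) 1) (hy : z.2 ∈ Set.Ioo (0 : ℝ) 1) :
    Tendsto (fun k => cutoff k z) atTop (𝓝 1) := by
  have h1 : Tendsto (fun k : ℕ => (k : ℝ) ^ 2 * stdWeight z) atTop atTop :=
    ((tendsto_pow_atTop two_ne_zero).comp tendsto_natCast_atTop_atTop).atTop_mul_const
      (stdWeight_pos hx hy)
  refine tendsto_const_nhds.congr' ?_
  filter_upwards [h1.eventually_ge_atTop 1] with k hk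
  exact (min_eq_left hk).symm

/-- The product of a function of the first coordinate with a cutoff function. -/
def cutWeight (f : Set.Ioo (0 : ℝ) 1 → ℝ) (k : ℕ) (z : ℝ × ℝ) : ℝ := extendIoo f z.1 * cutoff k z

theorem isWeight_cutWeight {f : Set.Ioo (0 : ℝ) 1 → ℝ} (hf : Continuous f) (h0 : ∀ x, 0 ≤ f x)
    {B : ℝ} (hB0 : 0 ≤ B) (hB : ∀ x, f x ≤ B) (k : ℕ) : IsWeight (cutWeight f k) where
  continuous := by
    rw [continuous_iff_continuousAt]
    intro z
    by_cases hz : z.1 ∈ Set.Ioo (0 : ℝ) 1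
    · exact ((continuousAt_extendIoo hf hz).comp continuousAt_fst).mul
        (isWeight_cutoff k).continuous.continuousAt
    · have h1 : cutWeight f k z = 0 := by simp [cutWeight, extendIoo, hz]
      have h2 : cutoff k z = 0 := by
        by_contra h
        exact hz ((isWeight_cutoff k).mem z h).1
      rw [ContinuousAt, h1]
      have h3 : Tendsto (fun w => B * cutoff k w) (𝓝 z) (𝓝 0) := by
        have := ((isWeight_cutoff k).continuous.tendsto z).const_mul B
        rwa [h2, mul_zero] at this
      exact squeeze_zero (fun w => mul_nonneg (extendIoo_nonneg h0 _) ((isWeight_cutoff k).nonneg w))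
        (fun w => mul_le_mul_of_nonneg_right (extendIoo_le hB0 hB _) ((isWeight_cutoff k).nonneg w)) h3
  nonneg z := mul_nonneg (extendIoo_nonneg h0 _) ((isWeight_cutoff k).nonneg z)
  mem z hz := (isWeight_cutoff k).mem z (right_ne_zero_of_mul hz)

/-- The marginal of the density on the natural extension is the Gauss density. -/
theorem integral_square_eq (f : Set.Ioo (0 : ℝ) 1 → ℝ) (hf : Continuous f)
    {B : ℝ} (hB : ∀ x, |f x| ≤ B) :
    ∫ z in Set.Ioo (0 : ℝ) 1 ×ˢ Set.Ioo (0 : ℝ) 1, extendIoo f z.1 / (1 + z.1 * z.2) ^ 2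
      = Real.log 2 * ∫ x, f x ∂gaussMeasure := by
  have e1 : ∫ x, f x ∂gaussMeasure = ∫ x : Set.Ioo (0 : ℝ) 1, extendIoo f x ∂gaussMeasure := by
    simp only [extendIoo_coe]
  rw [e1, integral_gaussMeasure, mul_inv_cancel_left₀ (Real.log_pos one_lt_two).ne',
    Measure.volume_eq_prod, setIntegral_prod]
  · refine setIntegral_congr_fun measurableSet_Ioo fun x hx => ?_
    have : ∀ y, extendIoo f x / (1 + x * y) ^ 2 = extendIoo f x * (1 / (1 + x * y) ^ 2) :=
      fun y => by ring
    simp only [this]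
    rw [integral_const_mul, integral_Ioo_one_div_sq hx.1, mul_one_div]
  · refine Measure.integrableOn_of_bounded (M := B) ?_ ?_ ?_
    · rw [Measure.prod_prod]
      simp
    · exact (((measurable_extendIoo hf).comp measurable_fst).div (by fun_prop)).aestronglyMeasurable
    · filter_upwards [ae_restrict_mem (measurableSet_Ioo.prod measurableSet_Ioo)] with z hz
      obtain ⟨hx, hy⟩ := hz
      have h1 : 0 < z.1 * z.2 := mul_pos hx.1 hy.1
      have h2 : |extendIoo f z.1| ≤ B := by
        rw [extendIoo, dif_pos hx]
        exact hB _
      rw [Real.norm_eq_abs, abs_div, abs_of_pos (by positivity : 0 < (1 + z.1 * z.2) ^ 2)]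
      exact (div_le_self (abs_nonneg _) (one_le_pow₀ (by linarith))).trans h2

theorem tendsto_weightIntegral_cutWeight {f : Set.Ioo (0 : ℝ) 1 → ℝ} (hf : Continuous f)
    (h0 : ∀ x, 0 ≤ f x) {B : ℝ} (hB0 : 0 ≤ B) (hB : ∀ x, f x ≤ B) :
    Tendsto (fun k => weightIntegral (cutWeight f k)) atTop
      (𝓝 (Real.log 2 * ∫ x, f x ∂gaussMeasure)) := by
  rw [← integral_square_eq f hf fun x => (abs_of_nonneg (h0 x)).trans_le (hB x)]
  have hsq : MeasurableSet (Set.Ioo (0 : ℝ) 1 ×ˢ Set.Ioo (0 : ℝ) 1) :=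
    measurableSet_Ioo.prod measurableSet_Ioo
  have e : ∀ k, weightIntegral (cutWeight f k)
      = ∫ z in Set.Ioo (0 : ℝ) 1 ×ˢ Set.Ioo (0 : ℝ) 1, cutWeight f k z / (1 + z.1 * z.2) ^ 2 := by
    intro k
    rw [weightIntegral, ← setIntegral_eq_integral_of_forall_compl_eq_zero]
    intro z hz
    have : cutWeight f k z = 0 := by
      by_contra h
      exact hz ((isWeight_cutWeight hf h0 hB0 hB k).mem z h)
    rw [this, zero_div]
  simp only [e]
  refine tendsto_integral_of_dominated_convergence (fun _ => B) (fun k => ?_) ?_ (fun k => ?_) ?_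
  · exact ((isWeight_cutWeight hf h0 hB0 hB k).continuous.measurable.div
      (by fun_prop)).aestronglyMeasurable
  · refine integrableOn_const ?_
    rw [Measure.volume_eq_prod, Measure.prod_prod]
    simp
  · filter_upwards [ae_restrict_mem hsq] with z hz
    have h1 : 0 < z.1 * z.2 := mul_pos hz.1.1 hz.2.1
    have h2 := (isWeight_cutWeight hf h0 hB0 hB k).nonneg z
    rw [Real.norm_of_nonneg (by positivity)]
    refine (div_le_self h2 (one_le_pow₀ (by linarith))).trans ?_
    exact (mul_le_of_le_one_right (extendIoo_nonneg h0 _) (cutoff_le_one k z)).trans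
      (extendIoo_le hB0 hB _)
  · filter_upwards [ae_restrict_mem hsq] with z hz
    have := ((tendsto_cutoff hz.1 hz.2).const_mul (extendIoo f z.1)).div_const
      ((1 + z.1 * z.2) ^ 2)
    rwa [mul_one] at this

theorem cfPair_succ_snd (α : ℝ) (n : ℕ) : (cfPair α (n + 1)).2 = cfDen α n / cfDen α (n + 1) := by
  rw [cfPair, cfMat_succ_one_zero]

section Irrational

variable {α : ℝ} (hα : Irrational α) (h : α ∈ Set.Ioo (0 : ℝ) 1)

include hα h

/-- A point of the Gauss orbit close to zero produces a large gap between denominators. -/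
theorem log_le_of_gaussMap_iterate_lt {n : ℕ} {r : ℝ} (hr : 0 < r) (hx : gaussMap^[n] α < 1 / (1 + r)) :
    Real.log r ≤ logDen α (n + 1) - logDen α n := by
  obtain ⟨hx0, -⟩ := gaussMap_iterate_mem_Ioo hα h n
  have hx1 := (gaussMap_iterate_mem_Ioo hα h (n + 1)).2
  have h1 : 1 + r < 1 / gaussMap^[n] α := by
    rw [lt_one_div (by linarith) hx0]
    exact hx
  rw [one_div_gaussMap_iterate] at h1
  have hq := cfDen_pos hα h n
  have h2 : r * cfDen α n ≤ cfDen α (n + 1) := by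
    have h3 : (cfDen α (n + 1) : ℝ) = cfMat α n 1 0 + cfDen α n * cfDigit α n := by
      exact_mod_cast cfDen_succ α n
    have h4 : (0 : ℝ) ≤ cfMat α n 1 0 := by exact_mod_cast (cfMat_one_zero_bounds hα h n).1
    rw [h3]
    nlinarith
  have h5 := Real.log_le_log (mul_pos hr hq) h2
  rw [Real.log_mul hr.ne' hq.ne'] at h5
  rw [logDen, logDen]
  linarith

/-- The ratios `y_n = q_{n-1} / q_n` satisfy `1 / y_{n+1} = b_{n+1} + y_n`. -/
theorem cfPair_snd_mul (n : ℕ) :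
    (cfPair α (n + 1)).2 * (cfDigit α n + (cfPair α n).2) = 1 := by
  have h1 := (cfDen_pos hα h n).ne'
  have h2 := (cfDen_pos hα h (n + 1)).ne'
  have h3 : (cfDen α (n + 1) : ℝ) = cfMat α n 1 0 + cfDen α n * cfDigit α n := by
    exact_mod_cast cfDen_succ α n
  rw [cfPair_succ_snd α, cfPair]
  simp only
  rw [div_mul_eq_mul_div, div_eq_iff h2, h3]
  field_simp
  ring

theorem log_le_of_cfPair_snd_lt {n : ℕ} {r : ℝ} (hr : 0 < r) (hy : (cfPair α (n + 1)).2 ≤ 1 / r) :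
    Real.log r ≤ logDen α (n + 1) - logDen α n := by
  have hq := cfDen_pos hα h n
  have hq' := cfDen_pos hα h (n + 1)
  rw [cfPair_succ_snd α, div_le_div_iff₀ hq' hr, one_mul] at hy
  have h5 := Real.log_le_log (mul_pos hq hr) hy
  rw [Real.log_mul hq.ne' hr.ne'] at h5
  rw [logDen, logDen]
  linarith

/-- Close to the boundary of the unit square the denominators have a large gap nearby. -/
theorem log_le_of_cutoff_ne_one {k : ℕ} (hk : 4 < k) {j : ℕ} (hc : cutoff k (cfPair α (j + 2)) ≠ 1) :
    Real.log (k / 4) ≤ logDen α (j + 4) - logDen α j := by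
  have hkR : (4 : ℝ) < k := by exact_mod_cast hk
  have hmono := logDen_monotone hα h
  have m1 := hmono (show j ≤ j + 1 by omega)
  have m2 := hmono (show j + 1 ≤ j + 2 by omega)
  have m3 := hmono (show j + 2 ≤ j + 3 by omega)
  have m4 := hmono (show j + 3 ≤ j + 4 by omega)
  have hk4 : (0 : ℝ) < k / 4 := by positivity
  have hkinv : (k : ℝ)⁻¹ < 1 / (1 + k / 4) := by
    rw [inv_eq_one_div]
    exact one_div_lt_one_div_of_lt (by positivity) (by linarith)
  -- if `s (b + s') = 1` with `b ≥ 1` and `s` is close to `1`, then `s'` is close to `0`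
  have hnear : ∀ {s s' : ℝ} {b : ℤ}, 0 < s → 1 ≤ b → s * (b + s') = 1 → 1 - s < (k : ℝ)⁻¹ →
      s' < 1 / (1 + k / 4) := by
    intro s s' b hs hb e hlt
    have hb' : (1 : ℝ) ≤ b := by exact_mod_cast hb
    have hki : (k : ℝ)⁻¹ * k = 1 := inv_mul_cancel₀ (by positivity)
    have h1 : (k : ℝ) - 1 < s * k := by nlinarith
    rw [lt_div_iff₀ (by positivity)]
    have h2 : s' ≤ (1 - s) / s := by
      rw [le_div_iff₀ hs]
      nlinarith
    have h3 : (1 - s) / s < 1 / (k - 1) := by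
      rw [div_lt_div_iff₀ hs (by linarith)]
      linarith
    have h4 : s' < 1 / (k - 1) := h2.trans_lt h3
    rw [lt_div_iff₀ (by linarith)] at h4
    by_cases hs' : 0 ≤ s'
    · nlinarith
    · nlinarith
  by_contra hlt
  push Not at hlt
  refine hc (cutoff_eq_one (by omega) ?_ ?_ ?_ ?_)
  · by_contra hx
    push Not at hx
    have := log_le_of_gaussMap_iterate_lt hα h hk4 (hx.trans hkinv)
    rw [show j + 2 + 1 = j + 3 by omega] at this
    linarith
  · by_contra hx
    push Not at hx
    have h1 := hnear (gaussMap_iterate_mem_Ioo hα h (j + 2)).1 (one_le_cfDigit hα h (j + 2))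
      (gaussMap_iterate_mul hα (j + 2)) hx
    have := log_le_of_gaussMap_iterate_lt hα h hk4 h1
    rw [show j + 2 + 1 = j + 3 by omega, show j + 3 + 1 = j + 4 by omega] at this
    linarith
  · by_contra hy
    push Not at hy
    have h1 : (cfPair α (j + 2)).2 ≤ 1 / (k / 4) := by
      refine hy.le.trans ?_
      rw [inv_eq_one_div]
      exact one_div_le_one_div_of_le hk4 (by linarith)
    have := log_le_of_cfPair_snd_lt hα h (n := j + 1) hk4 h1
    rw [show j + 1 + 1 = j + 2 by omega] at this
    linarith
  · by_contra hy
    push Not at hy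
    have hpos : 0 < (cfPair α (j + 2)).2 := by
      rw [cfPair_succ_snd α]
      exact div_pos (cfDen_pos hα h _) (cfDen_pos hα h _)
    have h1 := hnear hpos (one_le_cfDigit hα h (j + 1)) (cfPair_snd_mul hα h (j + 1)) hy
    have h2 : (cfPair α (j + 1)).2 ≤ 1 / (k / 4) :=
      h1.le.trans (one_div_le_one_div_of_le hk4 (by linarith))
    have := log_le_of_cfPair_snd_lt hα h (n := j) hk4 h2
    linarith

/-- The gaps over four steps telescope. -/
theorem sum_logDen_gap_le (M : ℕ) :
    ∑ j ∈ Finset.range M, (logDen α (j + 4) - logDen α j) ≤ 4 * logDen α (M + 4) := by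
  have hmono := logDen_monotone hα h
  have e : ∀ i, ∑ j ∈ Finset.range M, (logDen α (j + i + 1) - logDen α (j + i))
      = logDen α (M + i) - logDen α i := by
    intro i
    have := Finset.sum_range_sub (fun j => logDen α (j + i)) M
    rw [zero_add] at this
    rw [← this]
    refine Finset.sum_congr rfl fun j _ => ?_
    rw [show j + i + 1 = j + 1 + i by omega]
  have e2 : ∑ j ∈ Finset.range M, (logDen α (j + 4) - logDen α j)
      = ∑ i ∈ Finset.range 4, ∑ j ∈ Finset.range M,
          (logDen α (j + i + 1) - logDen α (j + i)) := by
    rw [Finset.sum_comm]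
    refine Finset.sum_congr rfl fun j _ => ?_
    exact (Finset.sum_range_sub (fun i => logDen α (j + i)) 4).symm
  rw [e2]
  refine (Finset.sum_le_card_nsmul _ _ (logDen α (M + 4)) fun i hi => ?_).trans (by simp)
  rw [e]
  have h1 := hmono (show M + i ≤ M + 4 by have := Finset.mem_range.1 hi; omega)
  linarith [logDen_nonneg hα h i]

/-- Few points of the natural extension lie close to the boundary of the unit square. -/
theorem sum_one_sub_cutoff_le {k : ℕ} (hk : 4 < k) (M : ℕ) :
    ∑ n ∈ Finset.range (M + 4), (1 - cutoff k (cfPair α n))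
      ≤ 4 + 4 / Real.log (k / 4) * logDen α (M + 4) := by
  have hkR : (4 : ℝ) < k := by exact_mod_cast hk
  have hl : 0 < Real.log (k / 4) := Real.log_pos (by linarith)
  have hw0 : ∀ n, 1 - cutoff k (cfPair α n) ≤ 1 := fun n => by
    linarith [(isWeight_cutoff k).nonneg (cfPair α n)]
  have hmono := logDen_monotone hα h
  have e1 : ∑ n ∈ Finset.range (M + 4), (1 - cutoff k (cfPair α n))
      = (∑ j ∈ Finset.range M, (1 - cutoff k (cfPair α (j + 2)))) + (1 - cutoff k (cfPair α 0))
        + (1 - cutoff k (cfPair α 1)) + (1 - cutoff k (cfPair α (M + 2)))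
        + (1 - cutoff k (cfPair α (M + 3))) := by
    have e : ∀ i, i + 1 + 1 = i + 2 := fun _ => rfl
    rw [Finset.sum_range_succ, Finset.sum_range_succ, Finset.sum_range_succ', Finset.sum_range_succ']
    simp only [e, zero_add]
    ring
  have e2 : ∑ j ∈ Finset.range M, (1 - cutoff k (cfPair α (j + 2)))
      ≤ ∑ j ∈ Finset.range M, (logDen α (j + 4) - logDen α j) / Real.log (k / 4) := by
    refine Finset.sum_le_sum fun j _ => ?_
    by_cases hc : cutoff k (cfPair α (j + 2)) = 1
    · rw [hc, sub_self]
      exact div_nonneg (sub_nonneg.2 (hmono (by omega))) hl.le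
    · refine (hw0 _).trans ?_
      rw [le_div_iff₀ hl, one_mul]
      exact log_le_of_cutoff_ne_one hα h hk hc
  rw [← Finset.sum_div] at e2
  have e3 := (div_le_div_iff_of_pos_right hl).2 (sum_logDen_gap_le hα h M)
  have e4 : 4 / Real.log (k / 4) * logDen α (M + 4) = 4 * logDen α (M + 4) / Real.log (k / 4) := by
    ring
  rw [e1, e4]
  linarith [hw0 0, hw0 1, hw0 (M + 2), hw0 (M + 3)]

theorem abs_sum_sub_sum_cutWeight_le {f : Set.Ioo (0 : ℝ) 1 → ℝ} (h0 : ∀ x, 0 ≤ f x)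
    {B : ℝ} (hB0 : 0 ≤ B) (hB : ∀ x, f x ≤ B) {k : ℕ} (hk : 4 < k) (M : ℕ) :
    |∑ n ∈ Finset.range (M + 4), extendIoo f (gaussMap^[n] α)
      - ∑ n ∈ Finset.range (M + 4), cutWeight f k (cfPair α n)|
      ≤ B * (4 + 4 / Real.log (k / 4) * logDen α (M + 4)) := by
  rw [← Finset.sum_sub_distrib]
  have e : ∀ n, extendIoo f (gaussMap^[n] α) - cutWeight f k (cfPair α n)
      = extendIoo f (gaussMap^[n] α) * (1 - cutoff k (cfPair α n)) := by
    intro n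
    rw [cutWeight, show (cfPair α n).1 = gaussMap^[n] α from rfl]
    ring
  have hw : ∀ n, 0 ≤ 1 - cutoff k (cfPair α n) := fun n => sub_nonneg.2 (cutoff_le_one _ _)
  simp only [e]
  rw [abs_of_nonneg (Finset.sum_nonneg fun n _ => mul_nonneg (extendIoo_nonneg h0 _) (hw n))]
  refine le_trans ?_ (mul_le_mul_of_nonneg_left (sum_one_sub_cutoff_le hα h hk M) hB0)
  rw [Finset.mul_sum]
  exact Finset.sum_le_sum fun n _ => mul_le_mul_of_nonneg_right (extendIoo_le hB0 hB _) (hw n)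

/-- Convergence of the averages, normalized by the logarithm of the denominator, passes from the
weights on the natural extension to nonnegative bounded continuous functions on `(0, 1)`. -/
theorem tendsto_sum_div_logDen_of_nonneg {c : ℝ}
    (hc : ∀ ψ : ℝ × ℝ → ℝ, IsWeight ψ →
      Tendsto (fun N => (∑ n ∈ Finset.range N, ψ (cfPair α n)) / logDen α N) atTop
        (𝓝 (c * weightIntegral ψ)))
    {f : Set.Ioo (0 : ℝ) 1 → ℝ} (hf : Continuous f) (h0 : ∀ x, 0 ≤ f x) {B : ℝ} (hB0 : 0 ≤ B)
    (hB : ∀ x, f x ≤ B) :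
    Tendsto (fun N => (∑ n ∈ Finset.range N, extendIoo f (gaussMap^[n] α)) / logDen α N) atTop
      (𝓝 (c * (Real.log 2 * ∫ x, f x ∂gaussMeasure))) := by
  set I := c * (Real.log 2 * ∫ x, f x ∂gaussMeasure) with hI
  rw [Metric.tendsto_atTop']
  intro ε hε
  have hL := tendsto_logDen hα h
  -- a cutoff that changes both the integral and, in the limit, the averages by less than `ε / 4`
  have h1 : ∀ᶠ k : ℕ in atTop, |c * weightIntegral (cutWeight f k) - I| < ε / 4 := by
    have := (tendsto_weightIntegral_cutWeight hf h0 hB0 hB).const_mul c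
    exact (Metric.tendsto_nhds.1 this) (ε / 4) (by positivity)
  have h2 : ∀ᶠ k : ℕ in atTop, B * (4 / Real.log (k / 4)) < ε / 4 := by
    have hlog : Tendsto (fun k : ℕ => Real.log ((k : ℝ) / 4)) atTop atTop :=
      Real.tendsto_log_atTop.comp (tendsto_natCast_atTop_atTop.atTop_div_const (by norm_num))
    have := (hlog.const_div_atTop 4).const_mul B
    rw [mul_zero] at this
    exact this.eventually_lt_const (by positivity)
  obtain ⟨k, hk1, hk2, hk4⟩ := (h1.and (h2.and (eventually_gt_atTop 4))).exists
  -- the average of the cut off function converges, and the boundary terms become negligible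
  have h3 : ∀ᶠ N in atTop, |(∑ n ∈ Finset.range N, cutWeight f k (cfPair α n)) / logDen α N
      - c * weightIntegral (cutWeight f k)| < ε / 4 :=
    (Metric.tendsto_nhds.1 (hc _ (isWeight_cutWeight hf h0 hB0 hB k))) (ε / 4) (by positivity)
  have h4 : ∀ᶠ N in atTop, B * 4 / logDen α N < ε / 4 :=
    (hL.const_div_atTop (B * 4)).eventually_lt_const (by positivity)
  obtain ⟨N₀, hN₀⟩ := eventually_atTop.1 (h3.and (h4.and
    ((hL.eventually_gt_atTop 0).and (eventually_ge_atTop 4))))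
  refine ⟨N₀, fun N hN => ?_⟩
  obtain ⟨h5, h6, h7, h8⟩ := hN₀ N hN.le
  obtain ⟨M, rfl⟩ : ∃ M, N = M + 4 := ⟨N - 4, by omega⟩
  have h9 := abs_sum_sub_sum_cutWeight_le hα h h0 hB0 hB hk4 M
  have h10 : |(∑ n ∈ Finset.range (M + 4), extendIoo f (gaussMap^[n] α)) / logDen α (M + 4)
      - (∑ n ∈ Finset.range (M + 4), cutWeight f k (cfPair α n)) / logDen α (M + 4)|
      < ε / 4 + ε / 4 := by
    rw [← sub_div, abs_div, abs_of_pos h7]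
    refine ((div_le_div_iff_of_pos_right h7).2 h9).trans_lt ?_
    have : B * (4 + 4 / Real.log (k / 4) * logDen α (M + 4)) / logDen α (M + 4)
        = B * 4 / logDen α (M + 4) + B * (4 / Real.log (k / 4)) := by
      field_simp
    rw [this]
    linarith
  rw [Real.dist_eq]
  rw [abs_lt] at *
  constructor <;> linarith [h10.1, h10.2, h5.1, h5.2, hk1.1, hk1.2]

theorem tendsto_sum_div_logDen {c : ℝ}
    (hc : ∀ ψ : ℝ × ℝ → ℝ, IsWeight ψ →
      Tendsto (fun N => (∑ n ∈ Finset.range N, ψ (cfPair α n)) / logDen α N) atTop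
        (𝓝 (c * weightIntegral ψ)))
    (f : Set.Ioo (0 : ℝ) 1 →ᵇ ℝ) :
    Tendsto (fun N => (∑ n ∈ Finset.range N, extendIoo f (gaussMap^[n] α)) / logDen α N) atTop
      (𝓝 (c * (Real.log 2 * ∫ x, f x ∂gaussMeasure))) := by
  have hf := fun x => abs_le.1 (f.norm_coe_le_norm x)
  have hn := norm_nonneg f
  have h1 := tendsto_sum_div_logDen_of_nonneg hα h hc (f := fun x => f x + ‖f‖)
    (f.continuous.add continuous_const) (fun x => by linarith [(hf x).1]) (B := 2 * ‖f‖)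
    (by positivity) (fun x => by linarith [(hf x).2])
  have h2 := tendsto_sum_div_logDen_of_nonneg hα h hc (f := fun _ => ‖f‖)
    continuous_const (fun _ => hn) (B := ‖f‖) hn (fun _ => le_rfl)
  have h3 := h1.sub h2
  rw [integral_add (f.integrable _) (integrable_const _)] at h3
  convert h3 using 2
  · rw [← sub_div, ← Finset.sum_sub_distrib]
    congr 1
    refine Finset.sum_congr rfl fun n _ => ?_
    have hx := gaussMap_iterate_mem_Ioo hα h n
    simp only [extendIoo, dif_pos hx]
    ring
  · ring

/-- Dividing by the limit for the constant function `1` removes both the constant `c` and the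
logarithm of the denominator. -/
theorem gaussOrbitEquidistributed_of_tendsto {c : ℝ} (hc0 : 0 < c)
    (hc : ∀ ψ : ℝ × ℝ → ℝ, IsWeight ψ →
      Tendsto (fun N => (∑ n ∈ Finset.range N, ψ (cfPair α n)) / logDen α N) atTop
        (𝓝 (c * weightIntegral ψ))) :
    GaussOrbitEquidistributed α := by
  refine ⟨fun n => ⟨gaussMap^[n] α, gaussMap_iterate_mem_Ioo hα h n⟩, fun n => rfl, fun f => ?_⟩
  have h1 := tendsto_sum_div_logDen hα h hc f
  have h2 := tendsto_sum_div_logDen hα h hc (BoundedContinuousFunction.const _ 1)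
  have hlog : 0 < Real.log 2 := Real.log_pos one_lt_two
  simp only [BoundedContinuousFunction.const_apply, integral_const, probReal_univ, smul_eq_mul,
    mul_one] at h2
  have h3 := h1.div h2 (by positivity)
  have e : c * (Real.log 2 * ∫ x, f x ∂gaussMeasure) / (c * Real.log 2)
      = ∫ x, f x ∂gaussMeasure := by field_simp
  rw [e] at h3
  refine h3.congr' ?_
  filter_upwards [(tendsto_logDen hα h).eventually_gt_atTop 0] with N hN
  have e1 : ∑ n ∈ Finset.range N, extendIoo (fun _ => 1) (gaussMap^[n] α) = N := by
    rw [Finset.sum_congr rfl fun n _ => extendIoo_coe _ ⟨_, gaussMap_iterate_mem_Ioo hα h n⟩]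
    simp
  have e2 : ∑ n ∈ Finset.range N, extendIoo f (gaussMap^[n] α)
      = ∑ n ∈ Finset.range N, f ⟨gaussMap^[n] α, gaussMap_iterate_mem_Ioo hα h n⟩ :=
    Finset.sum_congr rfl fun n _ => extendIoo_coe _ ⟨_, gaussMap_iterate_mem_Ioo hα h n⟩
  rw [Pi.div_apply, e1, e2, div_div_div_cancel_right₀ hN.ne', div_eq_inv_mul]

end Irrational

/-! ### Continuous images of equidistributed sequences -/

/-- The uniform measure on the first `N + 1` terms of a sequence; the shift by one makes it a
probability measure for every `N`. -/
def samplingMeasure {Y : Type*} [MeasurableSpace Y] (x : ℕ → Y) (N : ℕ) : Measure Y :=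
  ((N : ENNReal) + 1)⁻¹ • ∑ n ∈ Finset.range (N + 1), Measure.dirac (x n)

theorem samplingMeasure_apply {Y : Type*} [MeasurableSpace Y] (x : ℕ → Y) (N : ℕ) {s : Set Y}
    (hs : MeasurableSet s) :
    samplingMeasure x N s
      = ((N : ENNReal) + 1)⁻¹ * ∑ n ∈ Finset.range (N + 1), s.indicator 1 (x n) := by
  simp [samplingMeasure, Measure.dirac_apply' _ hs]

instance {Y : Type*} [MeasurableSpace Y] (x : ℕ → Y) (N : ℕ) :
    IsProbabilityMeasure (samplingMeasure x N) := by
  refine ⟨?_⟩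
  rw [samplingMeasure_apply x N MeasurableSet.univ]
  simp only [Set.indicator_univ, Pi.one_apply, Finset.sum_const, Finset.card_range, nsmul_eq_mul,
    mul_one, Nat.cast_add, Nat.cast_one]
  exact ENNReal.inv_mul_cancel (by simp) (by finiteness)

theorem seqEquidistributed_iff_tendsto {Y : Type*} [TopologicalSpace Y] [MeasurableSpace Y]
    [OpensMeasurableSpace Y] (x : ℕ → Y) (μ : Measure Y) [hμ : IsProbabilityMeasure μ] :
    SeqEquidistributed x μ ↔ Tendsto (β := ProbabilityMeasure Y)
      (fun N : ℕ => ⟨samplingMeasure x N, inferInstance⟩) atTop (𝓝 ⟨μ, hμ⟩) := by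
  refine Iff.trans ?_ ProbabilityMeasure.tendsto_iff_forall_integral_tendsto.symm
  refine forall_congr' fun F => ?_
  rw [← tendsto_add_atTop_iff_nat (f := fun N : ℕ =>
    (N : ℝ)⁻¹ * ∑ n ∈ Finset.range N, F (x n)) 1]
  have e : ∀ N : ℕ, ∫ y, F y ∂(samplingMeasure x N)
      = ((N + 1 : ℕ) : ℝ)⁻¹ * ∑ n ∈ Finset.range (N + 1), F (x n) := by
    intro N
    rw [samplingMeasure, integral_smul_measure, integral_finsetSum_measure]
    · simp only [integral_dirac' _ _ F.continuous.stronglyMeasurable, smul_eq_mul,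
        ENNReal.toReal_inv]
      congr 2
      rw [ENNReal.toReal_add (by simp) (by simp)]
      simp
    · exact fun n _ => F.integrable _
  simp only [ProbabilityMeasure.coe_mk, e]

/-- Equidistribution passes to the image under a map that is continuous on a set of full measure
containing the sequence. -/
theorem SeqEquidistributed.map_of_continuousOn {Y Z : Type*} [TopologicalSpace Y]
    [MeasurableSpace Y] [OpensMeasurableSpace Y] [HasOuterApproxClosed Y] [TopologicalSpace Z]
    [MeasurableSpace Z] [OpensMeasurableSpace Z] {μ : Measure Y} [IsProbabilityMeasure μ]
    {x : ℕ → Y} (hx : SeqEquidistributed x μ) {g : Y → Z} {A : Set Y} (hxA : ∀ n, x n ∈ A)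
    (hA : ∀ᵐ y ∂μ, y ∈ A) (hg : ContinuousOn g A) (hgm : AEMeasurable g μ) :
    SeqEquidistributed (fun n => g (x n)) (μ.map g) := by
  have hp : IsProbabilityMeasure (μ.map g) := Measure.isProbabilityMeasure_map hgm
  rw [seqEquidistributed_iff_tendsto] at hx ⊢
  refine tendsto_of_forall_isOpen_le_liminf' fun G hG => ?_
  obtain ⟨U, hU, e⟩ := continuousOn_iff'.1 hg G hG
  have hle := ProbabilityMeasure.le_liminf_measure_open_of_tendsto hx hU
  have e1 : μ.map g G = μ U := by
    rw [Measure.map_apply_of_aemeasurable hgm hG.measurableSet]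
    refine measure_congr ?_
    filter_upwards [hA] with y hy
    have : y ∈ g ⁻¹' G ∩ A ↔ y ∈ U ∩ A := by rw [e]
    simp only [Set.mem_inter_iff, hy, and_true] at this
    exact propext this
  have e2 : ∀ N, samplingMeasure (fun n => g (x n)) N G = samplingMeasure x N U := by
    intro N
    rw [samplingMeasure_apply _ _ hG.measurableSet, samplingMeasure_apply _ _ hU.measurableSet]
    congr 1
    refine Finset.sum_congr rfl fun n _ => ?_
    have : x n ∈ g ⁻¹' G ∩ A ↔ x n ∈ U ∩ A := by rw [e]
    simp only [Set.mem_inter_iff, hxA n, and_true, Set.mem_preimage] at this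
    by_cases hn : x n ∈ U
    · rw [Set.indicator_of_mem hn, Set.indicator_of_mem (this.2 hn)]
      rfl
    · rw [Set.indicator_of_notMem hn, Set.indicator_of_notMem (fun h => hn (this.1 h))]
  simp only [ProbabilityMeasure.coe_mk, e1, e2] at hle ⊢
  exact hle

/-! ### The coding of irrational numbers by their continued fraction coefficients -/

/-- The digits of `x`, read off its Gauss orbit, as a sequence of positive integers. The conversion
to positive integers is faithful for irrational `x ∈ (0, 1)`, where all digits are positive. -/
def digitSeq (x : ℝ) (n : ℕ) : ℕ+ := (cfDigit x n).toNat.toPNat'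

theorem digitSeq_coe {x : ℝ} (hx : Irrational x) (h : x ∈ Set.Ioo (0 : ℝ) 1) (n : ℕ) :
    ((digitSeq x n : ℕ) : ℤ) = cfDigit x n := by
  have h1 := one_le_cfDigit hx h n
  rw [digitSeq, Nat.toPNat'_coe, if_pos (by omega), Int.toNat_of_nonneg (by omega)]

theorem stream_succ_eq {x : ℝ} (hx : Irrational x) (h : x ∈ Set.Ioo (0 : ℝ) 1) (n : ℕ) :
    GenContFract.IntFractPair.stream x (n + 1)
      = some ⟨cfDigit x n, gaussMap^[n + 1] x⟩ := by
  have key : ∀ y : ℝ, GenContFract.IntFractPair.of y⁻¹ = ⟨⌊1 / y⌋, gaussMap y⟩ := by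
    intro y
    rw [GenContFract.IntFractPair.of, ← one_div]
    rfl
  induction n with
  | zero =>
    have h0 : (GenContFract.IntFractPair.of x).fr = x := Int.fract_eq_self.2 ⟨h.1.le, h.2⟩
    rw [GenContFract.IntFractPair.stream_succ_of_some (GenContFract.IntFractPair.stream_zero x)
      (by rw [h0]; exact hx.ne_zero), h0, key]
    rfl
  | succ n ih =>
    rw [GenContFract.IntFractPair.stream_succ_of_some ih
      (gaussMap_iterate_irrational hx (n + 1)).ne_zero, key, ← Function.iterate_succ_apply' gaussMap (n + 1) x]
    rfl

theorem isCFSequence_iff {x : ℝ} (hx : Irrational x) (h : x ∈ Set.Ioo (0 : ℝ) 1) (b : ℕ → ℕ+) :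
    IsCFSequence x b ↔ b = digitSeq x := by
  have key : ∀ n, (GenContFract.of x).partDens.get? n = some (cfDigit x n : ℝ) := fun n =>
    GenContFract.partDen_eq_s_b
      (GenContFract.get?_of_eq_some_of_succ_get?_intFractPair_stream (stream_succ_eq hx h n))
  constructor
  · intro hb
    funext n
    have h1 := hb n
    rw [key n, Option.some.injEq] at h1
    have h2 := digitSeq_coe hx h n
    refine PNat.coe_injective ?_
    have h3 : cfDigit x n = ((b n : ℕ) : ℤ) := by exact_mod_cast h1
    omega
  · rintro rfl n
    rw [key n, ← digitSeq_coe hx h n]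
    norm_cast

theorem cfCode_eq {x : ℝ} (hx : Irrational x) (h : x ∈ Set.Ioo (0 : ℝ) 1) :
    cfCode x = digitSeq x := by
  have hex : ∃ b, IsCFSequence x b := ⟨digitSeq x, (isCFSequence_iff hx h _).2 rfl⟩
  rw [cfCode, dif_pos hex]
  exact (isCFSequence_iff hx h _).1 hex.choose_spec

theorem cfDigit_gaussMap_iterate (x : ℝ) (n k : ℕ) :
    cfDigit (gaussMap^[n] x) k = cfDigit x (k + n) := by
  rw [cfDigit, cfDigit, Function.iterate_add_apply]

theorem shift_iterate_digitSeq (x : ℝ) (n : ℕ) :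
    shift^[n] (digitSeq x) = digitSeq (gaussMap^[n] x) := by
  induction n with
  | zero => rfl
  | succ n ih =>
    rw [Function.iterate_succ_apply', ih]
    funext k
    rw [shift, digitSeq, digitSeq, cfDigit_gaussMap_iterate, cfDigit_gaussMap_iterate,
      Nat.add_right_comm, Nat.add_assoc]

theorem measurable_gaussMap : Measurable gaussMap := by
  have : Measurable fun x : ℝ => Int.fract (1 / x) := measurable_fract.comp (by fun_prop)
  exact this

theorem measurable_digitSeq : Measurable digitSeq := by
  refine measurable_pi_lambda _ fun n => ?_
  have h1 : Measurable fun x => cfDigit x n :=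
    Int.measurable_floor.comp ((measurable_gaussMap.iterate n).const_div 1)
  exact (measurable_from_top (f := fun k : ℤ => k.toNat.toPNat')).comp h1

theorem continuousAt_gaussMap {x : ℝ} (hx : Irrational x) : ContinuousAt gaussMap x := by
  have h1 : ContinuousAt (fun y : ℝ => 1 / y) x := continuousAt_const.div continuousAt_id hx.ne_zero
  have h2 : Irrational (1 / x) := by simpa using hx.inv
  exact (continuousAt_fract (fun hz => h2.ne_int _ hz)).comp h1

theorem continuousAt_gaussMap_iterate {x : ℝ} (hx : Irrational x) (n : ℕ) :
    ContinuousAt gaussMap^[n] x := by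
  induction n with
  | zero => exact continuousAt_id
  | succ n ih =>
    rw [Function.iterate_succ']
    exact (continuousAt_gaussMap (gaussMap_iterate_irrational hx n)).comp ih

theorem continuousAt_digitSeq {x : ℝ} (hx : Irrational x) : ContinuousAt digitSeq x := by
  refine continuousAt_pi.2 fun n => ?_
  have h1 : Irrational (1 / gaussMap^[n] x) := by
    simpa using (gaussMap_iterate_irrational hx n).inv
  have h2 : ContinuousAt (fun y => 1 / gaussMap^[n] y) x :=
    continuousAt_const.div (continuousAt_gaussMap_iterate hx n)
      (gaussMap_iterate_irrational hx n).ne_zero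
  have h3 : ContinuousAt (fun y => cfDigit y n) x := by
    have hlt := (Int.floor_le (1 / gaussMap^[n] x)).lt_of_ne (h1.ne_int _).symm
    refine (continuousAt_const (y := cfDigit x n)).congr ?_
    filter_upwards [h2.eventually (Ioo_mem_nhds hlt (Int.lt_floor_add_one _))] with y hy
    exact (Int.floor_eq_iff.2 ⟨hy.1.le, hy.2⟩).symm
  exact (continuous_of_discreteTopology (f := fun k : ℤ => k.toNat.toPNat')).continuousAt.comp h3

/-- The matrix of convergents depends on the digits only. -/
theorem cfMat_congr {x y : ℝ} {k : ℕ} (hxy : ∀ n < k, cfDigit x n = cfDigit y n) :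
    cfMat x k = cfMat y k := by
  induction k with
  | zero => rfl
  | succ k ih => rw [cfMat, cfMat, ih fun n hn => hxy n (hn.trans k.lt_succ_self), hxy k k.lt_succ_self]

/-- Numbers with the same first `k` digits are close. -/
theorem abs_sub_le_of_digitSeq_eq {x y : ℝ} (hx : Irrational x) (hx1 : x ∈ Set.Ioo (0 : ℝ) 1)
    (hy : Irrational y) (hy1 : y ∈ Set.Ioo (0 : ℝ) 1) {k : ℕ}
    (hxy : ∀ n < k, digitSeq x n = digitSeq y n) : |x - y| ≤ 1 / cfDen x k := by
  have hM : cfMat x k = cfMat y k := cfMat_congr fun n hn => by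
    rw [← digitSeq_coe hx hx1, ← digitSeq_coe hy hy1, hxy n hn]
  have ex := cfMat_moebius hx k
  have ey := cfMat_moebius hy k
  rw [← hM] at ey
  obtain ⟨hs0, hs1⟩ := gaussMap_iterate_mem_Ioo hx hx1 k
  obtain ⟨ht0, ht1⟩ := gaussMap_iterate_mem_Ioo hy hy1 k
  set s := gaussMap^[k] x
  set t := gaussMap^[k] y
  have hq : (1 : ℝ) ≤ cfDen x k := by exact_mod_cast one_le_cfDen hx hx1 k
  have hc : (0 : ℝ) ≤ cfMat x k 1 0 := by exact_mod_cast (cfMat_one_zero_bounds hx hx1 k).1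
  have hqe : (cfMat x k 1 1 : ℝ) = cfDen x k := rfl
  have hdet : |((cfMat x k).det : ℝ)| = 1 := by
    rw [det_cfMat]
    push_cast
    rw [abs_pow, abs_neg, abs_one, one_pow]
  have e : (x - y) * ((cfMat x k 1 0 * s + cfMat x k 1 1) * (cfMat x k 1 0 * t + cfMat x k 1 1))
      = (cfMat x k).det * (s - t) := by
    rw [Matrix.det_fin_two]
    push_cast
    linear_combination (cfMat x k 1 0 * t + cfMat x k 1 1) * ex
      - (cfMat x k 1 0 * s + cfMat x k 1 1) * ey
  have e2 : |x - y| * |(cfMat x k 1 0 * s + cfMat x k 1 1) * (cfMat x k 1 0 * t + cfMat x k 1 1)|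
      = |s - t| := by
    rw [← abs_mul, e, abs_mul, hdet, one_mul]
  have hst : |s - t| ≤ 1 := by rw [abs_le]; constructor <;> linarith
  have h1 : (cfDen x k : ℝ) ≤ cfMat x k 1 0 * s + cfMat x k 1 1 := by
    rw [hqe]; nlinarith [mul_nonneg hc hs0.le]
  have h2 : (1 : ℝ) ≤ cfMat x k 1 0 * t + cfMat x k 1 1 := by
    rw [hqe]; nlinarith [mul_nonneg hc ht0.le]
  have h3 : (cfDen x k : ℝ)
      ≤ |(cfMat x k 1 0 * s + cfMat x k 1 1) * (cfMat x k 1 0 * t + cfMat x k 1 1)| := by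
    refine le_trans ?_ (le_abs_self _)
    nlinarith
  rw [le_div_iff₀ (by linarith)]
  calc |x - y| * cfDen x k ≤ |x - y| * _ := mul_le_mul_of_nonneg_left h3 (abs_nonneg _)
    _ ≤ 1 := by rw [e2]; exact hst

/-- The irrational points of the unit interval. -/
def irrIoo : Set (Set.Ioo (0 : ℝ) 1) := {x | Irrational (x : ℝ)}

theorem countable_compl_irrIoo : irrIooᶜ.Countable := by
  have h : Set.Countable {x : ℝ | ¬ Irrational x} := by
    have : {x : ℝ | ¬ Irrational x} = Set.range ((↑) : ℚ → ℝ) := by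
      ext x
      simp [Irrational]
    rw [this]
    exact Set.countable_range _
  exact h.preimage Subtype.val_injective

theorem measurableSet_irrIoo : MeasurableSet irrIoo := by
  have := countable_compl_irrIoo.measurableSet.compl
  rwa [compl_compl] at this

theorem ae_mem_irrIoo : ∀ᵐ x ∂gaussMeasure, x ∈ irrIoo := by
  refine (withDensity_absolutelyContinuous _ _) ?_
  change (volume : Measure ℝ).comap Subtype.val irrIooᶜ = 0
  rw [(MeasurableEmbedding.subtype_coe measurableSet_Ioo).comap_apply]
  exact (countable_compl_irrIoo.image _).measure_zero _

theorem cfCode_ae_eq :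
    (fun x : Set.Ioo (0 : ℝ) 1 => cfCode x) =ᵐ[gaussMeasure] fun x => digitSeq x := by
  filter_upwards [ae_mem_irrIoo] with x hx
  exact cfCode_eq hx x.2

theorem measurable_digitSeq_coe : Measurable fun x : Set.Ioo (0 : ℝ) 1 => digitSeq x :=
  measurable_digitSeq.comp measurable_subtype_coe

theorem gaussMeasureSeq_eq :
    gaussMeasureSeq = gaussMeasure.map fun x : Set.Ioo (0 : ℝ) 1 => digitSeq x :=
  Measure.map_congr cfCode_ae_eq

instance : IsProbabilityMeasure gaussMeasureSeq := by
  rw [gaussMeasureSeq_eq]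
  exact Measure.isProbabilityMeasure_map measurable_digitSeq_coe.aemeasurable

theorem continuousOn_digitSeq : ContinuousOn (fun x : Set.Ioo (0 : ℝ) 1 => digitSeq x) irrIoo :=
  fun _ hx => ((continuousAt_digitSeq hx).comp continuousAt_subtype_val).continuousWithinAt

theorem exists_one_div_cfDen_lt {x : ℝ} (hx : Irrational x) (h : x ∈ Set.Ioo (0 : ℝ) 1) {ε : ℝ}
    (hε : 0 < ε) : ∃ k, 1 / (cfDen x k : ℝ) < ε := by
  obtain ⟨k, hk⟩ := ((tendsto_logDen hx h).eventually_gt_atTop (Real.log (1 / ε))).exists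
  refine ⟨k, ?_⟩
  have hq := cfDen_pos hx h k
  rw [logDen, Real.log_lt_log_iff (by positivity) hq] at hk
  exact (one_div_lt hε hq).1 hk

theorem injOn_digitSeq : Set.InjOn (fun x : Set.Ioo (0 : ℝ) 1 => digitSeq x) irrIoo := by
  intro x hx y hy e
  refine Subtype.ext ?_
  by_contra hne
  obtain ⟨k, hk⟩ := exists_one_div_cfDen_lt hx x.2 (abs_pos.2 (sub_ne_zero.2 hne))
  have := abs_sub_le_of_digitSeq_eq hx x.2 hy y.2 (k := k) fun n _ => congrFun e n
  linarith

/-- The value of a continued fraction with the given coefficients: the inverse of the coding on the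
irrational points. -/
def cfValue : (ℕ → ℕ+) → Set.Ioo (0 : ℝ) 1 :=
  have : Nonempty (Set.Ioo (0 : ℝ) 1) := ⟨⟨1 / 2, by norm_num, by norm_num⟩⟩
  Function.invFunOn (fun x : Set.Ioo (0 : ℝ) 1 => digitSeq x) irrIoo

theorem cfValue_digitSeq {x : Set.Ioo (0 : ℝ) 1} (hx : x ∈ irrIoo) : cfValue (digitSeq x) = x := by
  have : Nonempty (Set.Ioo (0 : ℝ) 1) := ⟨x⟩
  exact injOn_digitSeq.leftInvOn_invFunOn hx

theorem continuousOn_cfValue :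
    ContinuousOn cfValue ((fun x : Set.Ioo (0 : ℝ) 1 => digitSeq x) '' irrIoo) := by
  rintro _ ⟨x, hx, rfl⟩
  rw [ContinuousWithinAt, Metric.tendsto_nhds]
  intro ε hε
  obtain ⟨k, hk⟩ := exists_one_div_cfDen_lt hx x.2 hε
  -- the sequences with the same first `k` digits form a neighborhood
  have hnhds : ∀ᶠ b : ℕ → ℕ+ in 𝓝 (digitSeq x), ∀ n ∈ Finset.range k, b n = digitSeq x n := by
    rw [Filter.eventually_all_finset]
    intro n _
    exact ((isOpen_discrete {digitSeq x n}).preimage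
      (continuous_apply (A := fun _ : ℕ => ℕ+) n)).mem_nhds rfl
  filter_upwards [mem_nhdsWithin_of_mem_nhds hnhds, self_mem_nhdsWithin] with b hb hbA
  obtain ⟨y, hy, rfl⟩ := hbA
  simp only
  rw [cfValue_digitSeq hy, cfValue_digitSeq hx, dist_comm, Subtype.dist_eq, Real.dist_eq]
  exact (abs_sub_le_of_digitSeq_eq hx x.2 hy y.2 fun n hn =>
    (hb n (Finset.mem_range.2 hn)).symm).trans_lt hk

theorem measurableSet_image_digitSeq :
    MeasurableSet ((fun x : Set.Ioo (0 : ℝ) 1 => digitSeq x) '' irrIoo) := by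
  have : StandardBorelSpace (Set.Ioo (0 : ℝ) 1) := measurableSet_Ioo.standardBorel
  exact measurableSet_irrIoo.image_of_measurable_injOn measurable_digitSeq_coe injOn_digitSeq

theorem ae_mem_image_digitSeq :
    ∀ᵐ b ∂gaussMeasureSeq, b ∈ (fun x : Set.Ioo (0 : ℝ) 1 => digitSeq x) '' irrIoo := by
  rw [gaussMeasureSeq_eq]
  refine (ae_map_iff measurable_digitSeq_coe.aemeasurable measurableSet_image_digitSeq).2 ?_
  filter_upwards [ae_mem_irrIoo] with x hx
  exact ⟨x, hx, rfl⟩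

theorem aemeasurable_cfValue : AEMeasurable cfValue gaussMeasureSeq := by
  have := continuousOn_cfValue.aemeasurable (μ := gaussMeasureSeq) measurableSet_image_digitSeq
  rwa [Measure.restrict_eq_self_of_ae_mem ae_mem_image_digitSeq] at this

theorem map_cfValue_gaussMeasureSeq : gaussMeasureSeq.map cfValue = gaussMeasure := by
  have h := aemeasurable_cfValue
  rw [gaussMeasureSeq_eq] at h ⊢
  rw [AEMeasurable.map_map_of_aemeasurable h measurable_digitSeq_coe.aemeasurable]
  refine (Measure.map_congr ?_).trans Measure.map_id
  filter_upwards [ae_mem_irrIoo] with x hx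
  exact cfValue_digitSeq hx

/-- The two forms of the conclusion are images of each other under the coding by digits and its
inverse. -/
theorem gaussOrbitEquidistributed_iff {α : ℝ} (hα : Irrational α) (h : α ∈ Set.Ioo (0 : ℝ) 1) :
    GaussOrbitEquidistributed α ↔ CFShiftsEquidistributed α := by
  let x : ℕ → Set.Ioo (0 : ℝ) 1 := fun n => ⟨gaussMap^[n] α, gaussMap_iterate_mem_Ioo hα h n⟩
  have hx : ∀ n, x n ∈ irrIoo := fun n => gaussMap_iterate_irrational hα n
  constructor
  · rintro ⟨x', hx', heq⟩
    obtain rfl : x' = x := funext fun n => Subtype.ext (hx' n)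
    refine ⟨digitSeq α, (isCFSequence_iff hα h _).2 rfl, ?_⟩
    rw [gaussMeasureSeq_eq]
    simp only [shift_iterate_digitSeq]
    exact heq.map_of_continuousOn hx ae_mem_irrIoo continuousOn_digitSeq
      measurable_digitSeq_coe.aemeasurable
  · rintro ⟨b, hb, heq⟩
    rw [(isCFSequence_iff hα h b).1 hb] at heq
    refine ⟨x, fun n => rfl, ?_⟩
    rw [← map_cfValue_gaussMeasureSeq]
    have hmem : ∀ n, shift^[n] (digitSeq α)
        ∈ (fun x : Set.Ioo (0 : ℝ) 1 => digitSeq x) '' irrIoo := fun n =>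
      ⟨x n, hx n, (shift_iterate_digitSeq α n).symm⟩
    -- weak convergence on sequences of positive integers is tested on open sets, which uses that
    -- this space is metrizable
    let := TopologicalSpace.pseudoMetrizableSpacePseudoMetric (ℕ → ℕ+)
    have := heq.map_of_continuousOn hmem ae_mem_image_digitSeq continuousOn_cfValue
      aemeasurable_cfValue
    refine (congrArg (fun y => SeqEquidistributed y _) (funext fun n => ?_)).mp this
    rw [shift_iterate_digitSeq]
    exact cfValue_digitSeq (hx n)

end GaussEquidistribution

end

theorem mainTheorem11 (α : ℝ) (hα : α ∈ Set.Ioo (0 : ℝ) 1) :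
    (∀ (m : MeasureTheory.Measure GaussEquidistribution.X)
        [MeasureTheory.IsProbabilityMeasure m]
        [MeasureTheory.SMulInvariantMeasure PGL(2, ℝ) GaussEquidistribution.X m],
      GaussEquidistribution.PathEquidistributed
        (fun t => GaussEquidistribution.a t • GaussEquidistribution.u α • GaussEquidistribution.x₀)
        m →
      GaussEquidistribution.GaussOrbitEquidistributed α ∧
        GaussEquidistribution.CFShiftsEquidistributed α) ∧
    (Irrational α →
      (GaussEquidistribution.GaussOrbitEquidistributed α ↔
        GaussEquidistribution.CFShiftsEquidistributed α)) := by
  refine ⟨fun m _ _ heq => ?_,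
    fun hirr => GaussEquidistribution.gaussOrbitEquidistributed_iff hirr hα⟩
  have hirr := GaussEquidistribution.irrational_of_pathEquidistributed m heq
  obtain ⟨c, hc, hlim⟩ := GaussEquidistribution.exists_tendsto_sum_div_logDen hirr hα m heq
  have ha := GaussEquidistribution.gaussOrbitEquidistributed_of_tendsto hirr hα hc hlim
  exact ⟨ha, (GaussEquidistribution.gaussOrbitEquidistributed_iff hirr hα).1 ha⟩
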